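/- \textbf{Theorem ($G$-Sampler).} Let $\mathcal G$ be the class of functions $G:[0,\infty)\to[0,\infty)$ of the form \[G(z)=c\,\mathbf 1[z>0]+\gamma_0 z+\int_{(0,\infty)}(1-e^{-rz})\,\nu(dr),\] with $c,\gamma_0\ge 0$ and $\nu$ a measure on $(0,\infty)$ such that $\int_{(0,\infty)}\min(r,1)\,\nu(dr)<\infty$. Fix any $G\in\mathcal G$. There is a non-negative L\'evy process $(X_t)_{t\ge 0}$ with values in $[0,\infty]$ that corresponds to $G$, that is, $\mathbb E\,e^{-zX_t}=e^{-tG(z)}$ for all $t,z\ge 0$ (with $e^{-\infty}=0$ and $0\cdot\infty=0$). Here a non-negative L\'evy process is one with $X_0=0$ almost surely, $\lim_{t\searrow 0}\mathbb P(X_t>\epsilon)=0$ for all $\epsilon>0$, and stationary independent increments; since $X$ may reach $\infty$, the latter means that for $0=t_0\le t_1\le\dots\le t_m$ the vector $(X_{t_1},\dots,X_{t_m})$ is distributed as the partial sums $(\xi_1,\xi_1+\xi_2,\dots,\xi_1+\dots+\xi_m)$ of independent $[0,\infty]$-valued $\xi_i\sim X_{t_i-t_{i-1}}$. Let $X$ be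 any such process corresponding to $G$, and let $\ell_G(a,b)=\inf\{t\ge 0 : \mathbb P(X_t\ge a)\ge b\}$, with $\inf\emptyset=\infty$. Let $H(1),\dots,H(n)$ be uniform on $[0,1]$ and let $Y_1,Y_2,\dots$ be $\mathrm{Exp}(1)$, all of them mutually independent. The generic $G$-Sampler processes a fixed stream of updates $(v_i,\Delta_i)\in[n]\times(0,\infty)$, $i=1,2,\dots$, to a vector $\mathbf x\in\mathbb R_+^n$ that is initially $0$; the $i$-th update sets $\mathbf x(v_i)\gets\mathbf x(v_i)+\Delta_i$. The sampler stores only a pair (two words) $(v_*,h_*)\in([n]\cup\{\perp\})\times[0,\infty]$, initially $(\perp,\infty)$. At the $i$-th update it computes $h_i=\ell_G(Y_i/\Delta_i,H(v_i))$, and if $h_i<h_*$ it sets $(v_*,h_*)\gets(v_i,h_i)$. Then after any number $k\ge 0$ of updates, with $\mathbf x$ the current vector and $G(\mathbf x)=\sum_{v\in[n]}G(\mathbf x(v))$: \begin{itemize} \item $h_*=\min_{i\le k}h_i$ (which is $\infty$ if $k=0$), and if $v_*\ne\perp$ then $v_*=v_i$ for some $i\le k$ with $h_i=h_*$; \item if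 $G(\mathbf x)>0$, then almost surely $v_*\neq\perp$ and $h_*<\infty$; moreover $\mathbb P(v_*=v)=G(\mathbf x(v))/G(\mathbf x)$ for every $v\in[n]$, and $h_*\sim\mathrm{Exp}(G(\mathbf x))$. \end{itemize} -/

import Mathlib

open MeasureTheory ProbabilityTheory Filter Topology
open scoped NNReal ENNReal

noncomputable section

namespace GSampler

/-- The class `𝒢` of functions `G(z) = c·1[z > 0] + γ₀ z + ∫_{(0,∞)} (1 - e^{-rz}) ν(dr)` on `[0,∞)`,
with `c, γ₀ ≥ 0` and `ν` a measure on `(0,∞)` with `∫ min(r,1) ν(dr) < ∞`. The measure is given as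
a measure on `ℝ`, of which only the restriction to `(0,∞)` is used. -/
def ClassG : Set (ℝ≥0 → ℝ) :=
  {G | ∃ (c γ₀ : ℝ≥0) (ν : Measure ℝ),
    (∫⁻ r in Set.Ioi (0 : ℝ), ENNReal.ofReal (min r 1) ∂ν) < ∞ ∧
    ∀ z : ℝ≥0, G z = (c : ℝ) * (if 0 < z then 1 else 0) + (γ₀ : ℝ) * (z : ℝ)
      + ∫ r in Set.Ioi (0 : ℝ), (1 - Real.exp (-(r * (z : ℝ)))) ∂ν}

/-- Non-negative Lévy processes, with values in `[0,∞]`. After the process has reached `∞` the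
differences `X_t - X_s` are of the form `∞ - ∞`, so independence and stationarity of the increments
are expressed by addition: for `0 = t₀ ≤ t₁ ≤ ⋯ ≤ t_m` the vector `(X_{t₁}, …, X_{t_m})` has the law
of the partial sums `(ξ₁, ξ₁ + ξ₂, …, ξ₁ + ⋯ + ξ_m)` of independent `[0,∞]`-valued variables `ξᵢ`,
where `ξᵢ` has the law of `X_{tᵢ - tᵢ₋₁}`. For finite-valued `X` this says exactly that the
differences `X_{tᵢ} - X_{tᵢ₋₁}` are independent with the laws of `X_{tᵢ - tᵢ₋₁}`. -/
structure IsNonnegLevyProcess {Ω : Type*} [MeasurableSpace Ω] (P : Measure Ω)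
    (X : ℝ≥0 → Ω → ℝ≥0∞) : Prop where
  measurable : ∀ t, Measurable (X t)
  increments : ∀ (m : ℕ) (t : Fin (m + 1) → ℝ≥0), Monotone t → t 0 = 0 →
    P.map (fun ω (i : Fin m) => X (t i.succ) ω) =
      (Measure.pi fun i : Fin m => P.map (X (t i.succ - t i.castSucc))).map
        (fun (ξ : Fin m → ℝ≥0∞) (i : Fin m) => ∑ j ∈ Finset.Iic i, ξ j)
  zero : ∀ᵐ ω ∂P, X 0 ω = 0
  stochasticContinuity : ∀ ε : ℝ≥0∞, 0 < ε →
    Tendsto (fun t : ℝ≥0 => P {ω | ε < X t ω}) (𝓝[>] 0) (𝓝 0)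

/-- `E e^{-z X_t} = e^{-t G(z)}` for all `t, z ≥ 0`, with `e^{-∞} = 0` and `0 · ∞ = 0`. -/
def HasLaplaceExponent {Ω : Type*} [MeasurableSpace Ω] (P : Measure Ω)
    (X : ℝ≥0 → Ω → ℝ≥0∞) (G : ℝ≥0 → ℝ) : Prop :=
  ∀ t z : ℝ≥0, ∫⁻ ω, EReal.exp (-(((z : ℝ≥0∞) * X t ω : ℝ≥0∞) : EReal)) ∂P =
    ENNReal.ofReal (Real.exp (-((t : ℝ) * G z)))

/-- `X` is a non-negative Lévy process (on the probability space `(Ω, P)`) corresponding to `G`. -/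
structure IsLevyProcessOf {Ω : Type*} [MeasurableSpace Ω] (P : Measure Ω)
    (X : ℝ≥0 → Ω → ℝ≥0∞) (G : ℝ≥0 → ℝ) : Prop where
  isProbabilityMeasure : IsProbabilityMeasure P
  isNonnegLevyProcess : IsNonnegLevyProcess P X
  hasLaplaceExponent : HasLaplaceExponent P X G

/-- The level function `ℓ(a,b) = inf {t ≥ 0 | P(X_t ≥ a) ≥ b}` induced by the process `X`, where
`inf ∅ = ∞`. -/
def levelFunction {Ω : Type*} [MeasurableSpace Ω] (P : Measure Ω)
    (X : ℝ≥0 → Ω → ℝ≥0∞) (a b : ℝ) : ℝ≥0∞ :=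
  ⨅ (t : ℝ≥0) (_ : ENNReal.ofReal b ≤ P {ω | ENNReal.ofReal a ≤ X t ω}), (t : ℝ≥0∞)

/-- The two-word memory `(v_*, h_*)`, where `none` stands for `⊥`. -/
abbrev Memory (n : ℕ) : Type := Option (Fin n) × ℝ≥0∞

/-- One call `Update(v, Δ)` with level function `ℓ`, fresh randomness `y` and hash value `u = H(v)`. -/
def update {n : ℕ} (ℓ : ℝ → ℝ → ℝ≥0∞) (s : Memory n) (v : Fin n) (Δ : ℝ≥0) (y u : ℝ) : Memory n :=
  if ℓ (y / Δ) u < s.2 then (some v, ℓ (y / Δ) u) else s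

/-- The memory after the first `k` updates `(v 0, Δ 0), …, (v (k-1), Δ (k-1))`, run with hash
function `H` and fresh random numbers `Y 0, Y 1, …`. -/
def run {n : ℕ} (ℓ : ℝ → ℝ → ℝ≥0∞) (v : ℕ → Fin n) (Δ : ℕ → ℝ≥0) (H : Fin n → ℝ) (Y : ℕ → ℝ) :
    ℕ → Memory n
  | 0 => (none, ∞)
  | k + 1 => update ℓ (run ℓ v Δ H Y k) (v k) (Δ k) (Y k) (H (v k))

/-- The vector `x` after the first `k` updates, starting from `0`. -/
def streamVector {n : ℕ} (v : ℕ → Fin n) (Δ : ℕ → ℝ≥0) (k : ℕ) (w : Fin n) : ℝ≥0 :=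
  ∑ i ∈ Finset.range k, if v i = w then Δ i else 0

/-- The `G`-moment `G(x) = ∑_w G(x(w))`. -/
def moment {n : ℕ} (G : ℝ≥0 → ℝ) (x : Fin n → ℝ≥0) : ℝ := ∑ w, G (x w)

end GSampler

end

/-! The sampler is a race of independent exponential clocks, one per coordinate. All updates to a
coordinate w share the uniform H(w), and up to a boundary case their levels all exceed t exactly
when P(X_t ≥ Y_i/Δ_i) < H(w) for every such i. Given the Y_i this has probability P(X_t < min
Y_i/Δ_i), so the uniform can be traded for an independent copy of X_t. Given X_t, the exponential
Y_i contribute ∏ e^{-Δ_i X_t} = e^{-x(w) X_t}, whose mean is e^{-t G(x(w))}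
(`prod_uniform_expMeasure_forall_lt`). Hence the least level of w has the tail of a clock of rate
G(x(w)), which never rings if the rate is 0.

Distinct coordinates use disjoint randomness, so rates add under minima (`measure_lt_minLevel`), and
w rings strictly first with probability G(x(w))/G(x) (`measure_lt_of_indepFun_exponential`). This
bounds P(v_* = w) only from below, but the bounds sum to 1 and the events are disjoint, so equality
holds and ties need no separate treatment.

For existence, X_t is a drift plus the sum of the jumps up to time t of a Poisson random measure
with intensity dt ⊗ μ, where μ is ν together with an atom of mass c at ∞ (killing). The Laplace
functional makes the joint transform of the increments a product
(`lintegral_expNeg_sum_subordinatorIncrement`), and `ext_of_laplace` turns this into independence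
and stationarity. -/

/-! ### The exponential on `[0,∞]` and uniqueness of Laplace transforms. -/

/-- The function `x ↦ e^{-x}` on `[0,∞]`, with `e^{-∞} = 0`. -/
noncomputable def expNeg (x : ℝ≥0∞) : ℝ≥0∞ := EReal.exp (-(x : EReal))

lemma expNeg_zero : expNeg 0 = 1 := by simp [expNeg]

lemma expNeg_top : expNeg ∞ = 0 := by simp [expNeg]

lemma expNeg_coe (x : ℝ≥0) : expNeg x = ENNReal.ofReal (Real.exp (-x)) := by
  have : (-((x : ℝ≥0∞) : EReal)) = ((-(x : ℝ) : ℝ) : EReal) := by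
    rw [EReal.coe_neg]; rfl
  rw [expNeg, this, EReal.exp_coe]

lemma expNeg_ofReal {x : ℝ} (hx : 0 ≤ x) :
    expNeg (ENNReal.ofReal x) = ENNReal.ofReal (Real.exp (-x)) := by
  rw [ENNReal.ofReal, expNeg_coe, Real.coe_toNNReal x hx]

lemma expNeg_strictAnti : StrictAnti expNeg := fun _ _ h =>
  EReal.exp_strictMono (EReal.neg_lt_neg_iff.2 (EReal.coe_ennreal_strictMono h))

lemma expNeg_le_one (x : ℝ≥0∞) : expNeg x ≤ 1 :=
  expNeg_zero ▸ expNeg_strictAnti.antitone zero_le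

lemma expNeg_ne_top (x : ℝ≥0∞) : expNeg x ≠ ∞ :=
  ((expNeg_le_one x).trans_lt ENNReal.one_lt_top).ne

lemma continuous_expNeg : Continuous expNeg :=
  ENNReal.continuous_exp.comp (continuous_neg.comp continuous_coe_ennreal_ereal)

lemma measurable_expNeg : Measurable expNeg := continuous_expNeg.measurable

lemma Measurable.expNeg {α : Type*} [MeasurableSpace α] {f : α → ℝ≥0∞} (hf : Measurable f) :
    Measurable fun x => expNeg (f x) :=
  measurable_expNeg.comp hf

lemma expNeg_add (x y : ℝ≥0∞) : expNeg (x + y) = expNeg x * expNeg y := by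
  induction x with
  | top => simp [expNeg_top]
  | coe x =>
    induction y with
    | top => simp [expNeg_top]
    | coe y =>
      rw [← ENNReal.coe_add, expNeg_coe, expNeg_coe, expNeg_coe,
        ← ENNReal.ofReal_mul (Real.exp_nonneg _), ← Real.exp_add]
      congr 2
      push_cast; ring

lemma expNeg_sum {ι : Type*} (s : Finset ι) (f : ι → ℝ≥0∞) :
    expNeg (∑ i ∈ s, f i) = ∏ i ∈ s, expNeg (f i) := by
  classical
  induction s using Finset.induction_on with
  | empty => simp [expNeg_zero]
  | insert a s ha ih => rw [Finset.sum_insert ha, Finset.prod_insert ha, expNeg_add, ih]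

lemma expNeg_natCast_mul (k : ℕ) (x : ℝ≥0∞) : expNeg (k * x) = expNeg x ^ k := by
  have := expNeg_sum (Finset.range k) (fun _ => x)
  simpa using this

/-- A finite measure on `[0,∞]^ι` is determined by its Laplace transform. -/
theorem ext_of_laplace {ι : Type*} [Fintype ι] {μ ν : Measure (ι → ℝ≥0∞)}
    [IsFiniteMeasure μ] [IsFiniteMeasure ν]
    (h : ∀ z : ι → ℝ≥0, ∫⁻ x, expNeg (∑ i, z i * x i) ∂μ = ∫⁻ x, expNeg (∑ i, z i * x i) ∂ν) :
    μ = ν := by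
  have hcont : Continuous fun (x : ι → ℝ≥0∞) (i : ι) => (expNeg (x i)).toReal :=
    continuous_pi fun i =>
      ENNReal.continuousOn_toReal.comp_continuous (continuous_expNeg.comp (continuous_apply i))
        fun x => expNeg_ne_top _
  set g : (ι → ℝ≥0∞) → ι → ℝ := fun x i => (expNeg (x i)).toReal with hg
  -- Polynomials in the functions e^{-x_i} separate the points of `[0,∞]^ι`, including points with
  -- infinite coordinates. Their monomials are the Laplace kernels with natural number parameters.
  let A : StarSubalgebra ℝ (BoundedContinuousFunction (ι → ℝ≥0∞) ℝ) :=
    { carrier := {f | ∃ p : MvPolynomial ι ℝ, ∀ x, f x = MvPolynomial.eval (g x) p}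
      mul_mem' := by
        rintro a b ⟨p, hp⟩ ⟨q, hq⟩
        exact ⟨p * q, fun x => by simp [hp, hq]⟩
      add_mem' := by
        rintro a b ⟨p, hp⟩ ⟨q, hq⟩
        exact ⟨p + q, fun x => by simp [hp, hq]⟩
      algebraMap_mem' := fun r => ⟨MvPolynomial.C r, fun x => by simp⟩
      star_mem' := by
        rintro a ⟨p, hp⟩
        exact ⟨p, fun x => by simp [hp]⟩ }
  refine ext_of_forall_mem_subalgebra_integral_eq_of_polish (𝕜 := ℝ) (A := A) ?_ ?_
  · intro x y hxy
    obtain ⟨i, hi⟩ := Function.ne_iff.1 hxy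
    refine ⟨fun x => g x i, ?_, ?_⟩
    · refine ⟨BoundedContinuousFunction.mkOfCompact ⟨fun x => g x i,
        (continuous_apply i).comp hcont⟩, ?_, rfl⟩
      exact ⟨_, ⟨MvPolynomial.X i, fun x => by simp⟩, rfl⟩
    · intro h
      exact hi (expNeg_strictAnti.injective
        ((ENNReal.toReal_eq_toReal_iff' (expNeg_ne_top _) (expNeg_ne_top _)).1 h))
  · rintro f ⟨p, hp⟩
    have key : ∀ d : ι →₀ ℕ, ∫ x, ∏ i, g x i ^ d i ∂μ = ∫ x, ∏ i, g x i ^ d i ∂ν := by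
      intro d
      have hd := h fun i => d i
      have hx : ∀ x, ∏ i, g x i ^ d i = (expNeg (∑ i, ((d i : ℝ≥0) : ℝ≥0∞) * x i)).toReal := by
        intro x
        simp [expNeg_sum, hg, ENNReal.toReal_prod, expNeg_natCast_mul]
      simp_rw [hx]
      have hm : Measurable fun x : ι → ℝ≥0∞ => expNeg (∑ i, ((d i : ℝ≥0) : ℝ≥0∞) * x i) :=
        measurable_expNeg.comp (by fun_prop)
      rw [integral_toReal hm.aemeasurable (.of_forall fun x => (expNeg_ne_top _).lt_top),
        integral_toReal hm.aemeasurable (.of_forall fun x => (expNeg_ne_top _).lt_top), hd]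
    have hint : ∀ (ρ : Measure (ι → ℝ≥0∞)) [IsFiniteMeasure ρ] (d : ι →₀ ℕ),
        Integrable (fun x => ∏ i, g x i ^ d i) ρ := by
      intro ρ _ d
      refine Integrable.of_bound (C := 1) ?_ (.of_forall fun x => ?_)
      · exact (continuous_finsetProd _ fun i _ =>
          ((continuous_apply i).comp hcont).pow _).aestronglyMeasurable
      · have h0 : ∀ i, 0 ≤ g x i ^ d i := fun i => pow_nonneg ENNReal.toReal_nonneg _
        rw [Real.norm_of_nonneg (Finset.prod_nonneg fun i _ => h0 i)]
        refine Finset.prod_le_one (fun i _ => h0 i) fun i _ => ?_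
        refine pow_le_one₀ ENNReal.toReal_nonneg ?_
        exact ENNReal.toReal_mono ENNReal.one_ne_top (expNeg_le_one _)
    simp_rw [hp, MvPolynomial.eval_eq']
    rw [integral_finsetSum _ fun d _ => (hint μ d).const_mul _,
      integral_finsetSum _ fun d _ => (hint ν d).const_mul _]
    exact Finset.sum_congr rfl fun d _ => by rw [integral_const_mul, integral_const_mul, key]

/-! ### Poisson random measures. -/

/-- Generating function of the Poisson law, summed by the exponential series. The bound on `a` keeps
the truncated difference `1 - a` genuine. -/
lemma lintegral_pow_poissonMeasure (r : ℝ≥0) (a : ℝ≥0) (ha : a ≤ 1) :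
    ∫⁻ n, (a : ℝ≥0∞) ^ n ∂(poissonMeasure r) = expNeg (r * (1 - a)) := by
  have h1 : (r * (1 - a) : ℝ≥0∞) = ((r * (1 - a) : ℝ≥0) : ℝ≥0∞) := by push_cast; rfl
  rw [h1, expNeg_coe, lintegral_countable']
  have h2 : ∀ n : ℕ, (a : ℝ≥0∞) ^ n * poissonMeasure r {n} =
      ENNReal.ofReal (Real.exp (-r) * ((r * a : ℝ) ^ n / n.factorial)) := by
    intro n
    rw [poissonMeasure_singleton, ← ENNReal.ofReal_coe_nnreal, ← ENNReal.ofReal_pow a.coe_nonneg,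
      ← ENNReal.ofReal_mul (by positivity)]
    congr 1; ring
  simp_rw [h2]
  rw [← ENNReal.ofReal_tsum_of_nonneg (fun n => by positivity)
    ((Real.summable_pow_div_factorial _).mul_left _), tsum_mul_left]
  have h3 : ∑' n : ℕ, (r * a : ℝ) ^ n / n.factorial = Real.exp (r * a) := by
    rw [Real.exp_eq_exp_ℝ, NormedSpace.exp_eq_tsum_div]
  rw [h3, ← Real.exp_add]
  congr 2
  push_cast [NNReal.coe_sub ha]
  ring

lemma lintegral_one_sub_expNeg {E : Type*} [MeasurableSpace E] (μ : Measure E)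
    [IsProbabilityMeasure μ] {f : E → ℝ≥0∞} (hf : Measurable f) :
    ∫⁻ x, (1 - expNeg (f x)) ∂μ = 1 - ∫⁻ x, expNeg (f x) ∂μ := by
  have hle : ∫⁻ x, expNeg (f x) ∂μ ≤ 1 :=
    (lintegral_mono fun x => expNeg_le_one (f x)).trans (by simp)
  rw [lintegral_sub hf.expNeg (hle.trans_lt ENNReal.one_lt_top).ne
    (.of_forall fun x => expNeg_le_one _)]
  simp

/-- Existence of Poisson random measures with finite intensity, given by their Laplace
functional. -/
theorem exists_poissonRandomMeasure_of_isFiniteMeasure {E : Type} [MeasurableSpace E] [Nonempty E]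
    (μ : Measure E) [IsFiniteMeasure μ] :
    ∃ (S : Type) (_ : MeasurableSpace S) (Q : Measure S) (N : S → Measure E),
      IsProbabilityMeasure Q ∧ Measurable N ∧ ∀ f : E → ℝ≥0∞, Measurable f →
        ∫⁻ ω, expNeg (∫⁻ x, f x ∂(N ω)) ∂Q = expNeg (∫⁻ x, (1 - expNeg (f x)) ∂μ) := by
  -- Normalise to total mass times a probability measure; for the zero measure any Dirac mass with
  -- `r = 0` will do.
  obtain ⟨κ, hκ, r, hμ⟩ : ∃ κ : Measure E, IsProbabilityMeasure κ ∧ ∃ r : ℝ≥0, μ = r • κ := by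
    rcases eq_or_ne μ 0 with rfl | h0
    · exact ⟨Measure.dirac (Classical.arbitrary E), inferInstance, 0, by simp⟩
    · have : NeZero μ := ⟨h0⟩
      refine ⟨(μ Set.univ)⁻¹ • μ, inferInstance, (μ Set.univ).toNNReal, ?_⟩
      ext s _
      have h1 : μ Set.univ ≠ 0 := by simpa using h0
      simp only [Measure.smul_apply, smul_eq_mul, ENNReal.smul_def]
      rw [ENNReal.coe_toNNReal (measure_ne_top _ _), ← mul_assoc,
        ENNReal.mul_inv_cancel h1 (measure_ne_top _ _), one_mul]
  -- A Poisson number of i.i.d. points of law `κ`.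
  let N : ℕ × (ℕ → E) → Measure E := fun p => ∑ i ∈ Finset.range p.1, Measure.dirac (p.2 i)
  have hN : Measurable N := by
    refine measurable_from_prod_countable_right fun n => ?_
    refine Measure.measurable_of_measurable_coe _ fun s hs => ?_
    simp only [N, Measure.finsetSum_apply]
    refine Finset.measurable_sum _ fun i _ => ?_
    exact (Measure.measurable_coe hs).comp (Measure.measurable_dirac.comp (measurable_pi_apply i))
  refine ⟨ℕ × (ℕ → E), inferInstance,
    (poissonMeasure r).prod (Measure.infinitePi fun _ => κ), N, inferInstance, hN,
    fun f hf => ?_⟩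
  have hm : Measurable fun x => expNeg (f x) := hf.expNeg
  have hFm : Measurable fun p => ∫⁻ x, f x ∂(N p) := (Measure.measurable_lintegral hf).comp hN
  rw [lintegral_prod _ hFm.expNeg.aemeasurable]
  have hind : iIndepFun (fun (i : ℕ) (ξ : ℕ → E) => expNeg (f (ξ i)))
      (Measure.infinitePi fun _ => κ) := iIndepFun_infinitePi (X := fun _ x => expNeg (f x))
      fun _ => hm
  have hinner : ∀ n : ℕ, ∫⁻ ξ, expNeg (∫⁻ x, f x ∂(N (n, ξ))) ∂(Measure.infinitePi fun _ => κ) =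
      (∫⁻ x, expNeg (f x) ∂κ) ^ n := by
    intro n
    simp only [N, lintegral_finsetSum_measure, lintegral_dirac' _ hf, expNeg_sum]
    rw [lintegral_prod_eq_prod_lintegral_of_indepFun _ _ hind
      fun i => hm.comp (measurable_pi_apply i)]
    have : ∀ i : ℕ, ∫⁻ ξ, expNeg (f (ξ i)) ∂(Measure.infinitePi fun _ => κ) =
        ∫⁻ x, expNeg (f x) ∂κ := fun i =>
      (measurePreserving_eval_infinitePi (fun _ : ℕ => κ) i).lintegral_comp hm
    simp [this]
  have hle : ∫⁻ x, expNeg (f x) ∂κ ≤ 1 :=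
    (lintegral_mono fun x => expNeg_le_one (f x)).trans (by simp)
  simp_rw [hinner]
  rw [hμ, lintegral_smul_measure, lintegral_one_sub_expNeg κ hf]
  lift ∫⁻ x, expNeg (f x) ∂κ to ℝ≥0 using (hle.trans_lt ENNReal.one_lt_top).ne with a
  rw [lintegral_pow_poissonMeasure r a (by exact_mod_cast hle)]
  rfl

/-- Existence of Poisson random measures with s-finite intensity, given by their Laplace
functional. -/
theorem exists_poissonRandomMeasure {E : Type} [MeasurableSpace E] [Nonempty E]
    (μ : Measure E) [SFinite μ] :
    ∃ (S : Type) (_ : MeasurableSpace S) (Q : Measure S) (N : S → Measure E),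
      IsProbabilityMeasure Q ∧ Measurable N ∧ ∀ f : E → ℝ≥0∞, Measurable f →
        ∫⁻ ω, expNeg (∫⁻ x, f x ∂(N ω)) ∂Q = expNeg (∫⁻ x, (1 - expNeg (f x)) ∂μ) := by
  choose S mS Q N hQ hN hL using
    fun k => exists_poissonRandomMeasure_of_isFiniteMeasure (sfiniteSeq μ k)
  -- Superpose independent Poisson random measures, one for each finite piece of `μ`.
  let M : (∀ k, S k) → Measure E := fun ω => Measure.sum fun k => N k (ω k)
  have hM : Measurable M := by
    refine Measure.measurable_of_measurable_coe _ fun s hs => ?_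
    simp only [M, Measure.sum_apply _ hs]
    exact Measurable.tsum fun k =>
      (Measure.measurable_coe hs).comp ((hN k).comp (measurable_pi_apply k))
  refine ⟨∀ k, S k, inferInstance, Measure.infinitePi Q, M, inferInstance, hM, fun f hf => ?_⟩
  set F : ∀ k, S k → ℝ≥0∞ := fun k ω => ∫⁻ x, f x ∂(N k ω) with hF
  have hFm : ∀ k, Measurable (F k) := fun k => (Measure.measurable_lintegral hf).comp (hN k)
  have hlim : ∀ a : ℕ → ℝ≥0∞, Tendsto (fun n => expNeg (∑ k ∈ Finset.range n, a k)) atTop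
      (𝓝 (expNeg (∑' k, a k))) := fun a =>
    (continuous_expNeg.tendsto _).comp ENNReal.summable.hasSum.tendsto_sum_nat
  have hfin : ∀ n, ∫⁻ ω : ∀ k, S k, expNeg (∑ k ∈ Finset.range n, F k (ω k))
      ∂(Measure.infinitePi Q) =
      expNeg (∑ k ∈ Finset.range n, ∫⁻ x, (1 - expNeg (f x)) ∂(sfiniteSeq μ k)) := by
    intro n
    simp only [expNeg_sum]
    rw [lintegral_prod_eq_prod_lintegral_of_indepFun (Finset.range n)
      (fun k (ω : ∀ k, S k) => expNeg (F k (ω k)))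
      (iIndepFun_infinitePi (X := fun k x => expNeg (F k x))
        fun k => measurable_expNeg.comp (hFm k))
      fun k => measurable_expNeg.comp ((hFm k).comp (measurable_pi_apply k))]
    refine Finset.prod_congr rfl fun k _ => ?_
    rw [← hL k f hf]
    exact (measurePreserving_eval_infinitePi Q k).lintegral_comp
      (measurable_expNeg.comp (hFm k))
  have h1 : ∫⁻ x, (1 - expNeg (f x)) ∂μ = ∑' k, ∫⁻ x, (1 - expNeg (f x)) ∂(sfiniteSeq μ k) := by
    rw [← lintegral_sum_measure, sum_sfiniteSeq]
  have h2 : ∀ ω, ∫⁻ x, f x ∂(M ω) = ∑' k, F k (ω k) := fun ω => by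
    simp only [M, hF, lintegral_sum_measure]
  rw [h1]
  simp_rw [h2]
  -- Both sides are limits of the transforms of finite superpositions; dominated convergence applies
  -- because the integrands are at most 1.
  refine tendsto_nhds_unique ?_ (hlim _)
  simp_rw [← hfin]
  refine tendsto_lintegral_of_dominated_convergence (fun _ => 1) (fun n => ?_)
    (fun n => .of_forall fun ω => expNeg_le_one _) (by simp)
    (.of_forall fun ω => hlim fun k => F k (ω k))
  exact measurable_expNeg.comp (Finset.measurable_sum _ fun k _ =>
    (hFm k).comp (measurable_pi_apply k))

/-! ### Subordinators built from a Poisson random measure. -/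

lemma lintegral_pi_expNeg_sum {ι : Type*} [Fintype ι] (μ : ι → Measure ℝ≥0∞)
    [∀ i, IsProbabilityMeasure (μ i)] (z : ι → ℝ≥0) :
    ∫⁻ x, expNeg (∑ i, z i * x i) ∂(Measure.pi μ) = ∏ i, ∫⁻ x, expNeg (z i * x) ∂(μ i) := by
  simp only [expNeg_sum]
  have hm : ∀ i, Measurable fun x => expNeg ((z i : ℝ≥0∞) * x) :=
    fun i => (measurable_const.mul measurable_id).expNeg
  rw [lintegral_prod_eq_prod_lintegral_of_indepFun Finset.univ
    (fun i (x : ι → ℝ≥0∞) => expNeg (z i * x i))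
    (iIndepFun_pi fun i => (hm i).aemeasurable) fun i => (hm i).comp (measurable_pi_apply i)]
  exact Finset.prod_congr rfl fun i _ => (measurePreserving_eval μ i).lintegral_comp (hm i)

/-- The exponent on `[0,∞)` of the subordinator with drift `d` and Lévy measure `μ` on `[0,∞]`. -/
noncomputable def bernsteinExponent (d : ℝ≥0) (μ : Measure ℝ≥0∞) (z : ℝ≥0) : ℝ≥0∞ :=
  d * z + ∫⁻ r, (1 - expNeg (z * r)) ∂μ

/-- The increment over `(s, t]` of the subordinator with drift `d` whose jumps are the atoms of
`N`. -/
noncomputable def subordinatorIncrement (d : ℝ≥0) (N : Measure (ℝ × ℝ≥0∞)) (s t : ℝ≥0) : ℝ≥0∞ :=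
  d * ((t - s : ℝ≥0) : ℝ≥0∞) + ∫⁻ p, (Set.Ioc (s : ℝ) t).indicator 1 p.1 * p.2 ∂N

lemma subordinatorIncrement_self (d : ℝ≥0) (N : Measure (ℝ × ℝ≥0∞)) (s : ℝ≥0) :
    subordinatorIncrement d N s s = 0 := by
  simp [subordinatorIncrement]

lemma measurable_indicator_Ioc_mul (s t : ℝ) :
    Measurable fun p : ℝ × ℝ≥0∞ => (Set.Ioc s t).indicator (1 : ℝ → ℝ≥0∞) p.1 * p.2 :=
  ((measurable_one.indicator measurableSet_Ioc).comp measurable_fst).mul measurable_snd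

lemma subordinatorIncrement_add (d : ℝ≥0) (N : Measure (ℝ × ℝ≥0∞)) {s t u : ℝ≥0} (hst : s ≤ t)
    (htu : t ≤ u) :
    subordinatorIncrement d N s t + subordinatorIncrement d N t u =
      subordinatorIncrement d N s u := by
  simp only [subordinatorIncrement]
  rw [add_add_add_comm, ← lintegral_add_left (measurable_indicator_Ioc_mul _ _), ← mul_add,
    ← ENNReal.coe_add, add_comm (t - s), tsub_add_tsub_cancel htu hst]
  congr 1
  refine lintegral_congr fun p => ?_
  rw [← add_mul, ← Set.Ioc_union_Ioc_eq_Ioc (NNReal.coe_le_coe.2 hst) (NNReal.coe_le_coe.2 htu),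
    Set.indicator_union_of_disjoint]
  rw [Set.disjoint_left]
  exact fun x hx hy => absurd hx.2 (not_le.2 hy.1)

lemma sum_subordinatorIncrement (d : ℝ≥0) (N : Measure (ℝ × ℝ≥0∞)) {m : ℕ} {t : Fin (m + 1) → ℝ≥0}
    (ht : Monotone t) (i : Fin m) :
    ∑ j ∈ Finset.Iic i, subordinatorIncrement d N (t j.castSucc) (t j.succ) =
      subordinatorIncrement d N (t 0) (t i.succ) := by
  obtain ⟨k, hk⟩ := i
  induction k with
  | zero =>
    have : Finset.Iic (⟨0, hk⟩ : Fin m) = {⟨0, hk⟩} := by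
      ext j; simp [Fin.le_def, Fin.ext_iff]
    rw [this, Finset.sum_singleton]
    rfl
  | succ k ih =>
    have : Finset.Iic (⟨k + 1, hk⟩ : Fin m) =
        insert ⟨k + 1, hk⟩ (Finset.Iic (⟨k, by omega⟩ : Fin m)) := by
      ext j; simp [Fin.le_def, Fin.ext_iff]; omega
    rw [this, Finset.sum_insert (by simp [Fin.le_def]), ih, add_comm]
    exact subordinatorIncrement_add d N (ht (Fin.zero_le _)) (ht (by simp [Fin.le_def]))

/-- A jump time lies in at most one of the disjoint sets, so at most one summand is nonzero and `1 -
expNeg` acts additively. This is the source of the independence of increments. -/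
lemma one_sub_expNeg_sum_indicator {ι : Type*} [Fintype ι] {I : ι → Set ℝ}
    (hI : Pairwise (Function.onFun Disjoint I)) (z : ι → ℝ≥0) (p : ℝ × ℝ≥0∞) :
    1 - expNeg (∑ j, z j * ((I j).indicator 1 p.1 * p.2)) =
      ∑ j, (I j).indicator 1 p.1 * (1 - expNeg (z j * p.2)) := by
  classical
  by_cases h : ∃ j, p.1 ∈ I j
  · obtain ⟨j, hj⟩ := h
    have hne : ∀ i, i ≠ j → p.1 ∉ I i := fun i hij hi =>
      Set.disjoint_left.1 (hI hij) hi hj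
    rw [Finset.sum_eq_single j (fun i _ hi => by simp [hne i hi]) (by simp),
      Finset.sum_eq_single j (fun i _ hi => by simp [hne i hi]) (by simp)]
    simp [hj]
  · push Not at h
    simp [h, expNeg_zero]

lemma pairwise_disjoint_Ioc_of_monotone {m : ℕ} {t : Fin (m + 1) → ℝ≥0} (ht : Monotone t) :
    Pairwise (Function.onFun Disjoint
      fun j : Fin m => Set.Ioc (t j.castSucc : ℝ) (t j.succ)) := by
  have key : ∀ i j : Fin m, i < j →
      Disjoint (Set.Ioc (t i.castSucc : ℝ) (t i.succ)) (Set.Ioc (t j.castSucc : ℝ) (t j.succ)) := by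
    intro i j hij
    rw [Set.disjoint_left]
    intro x hx hy
    have : (t i.succ : ℝ) ≤ t j.castSucc := ht (by rw [Fin.le_def]; simpa using hij)
    exact absurd hy.1 (not_lt.2 (hx.2.trans this))
  intro i j hij
  rcases lt_or_gt_of_ne hij with h | h
  · exact key i j h
  · exact (key j i h).symm

/-- Joint Laplace transform of the increments. -/
lemma lintegral_expNeg_sum_subordinatorIncrement {S : Type*} [MeasurableSpace S] {Q : Measure S}
    {μ : Measure ℝ≥0∞} [SFinite μ] {N : S → Measure (ℝ × ℝ≥0∞)}
    (hN : Measurable N)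
    (hL : ∀ f : ℝ × ℝ≥0∞ → ℝ≥0∞, Measurable f → ∫⁻ ω, expNeg (∫⁻ x, f x ∂(N ω)) ∂Q =
      expNeg (∫⁻ x, (1 - expNeg (f x)) ∂((volume : Measure ℝ).prod μ)))
    (d : ℝ≥0) {m : ℕ} {t : Fin (m + 1) → ℝ≥0} (ht : Monotone t) (z : Fin m → ℝ≥0) :
    ∫⁻ ω, expNeg (∑ j, z j * subordinatorIncrement d (N ω) (t j.castSucc) (t j.succ)) ∂Q =
      ∏ j, expNeg ((t j.succ - t j.castSucc : ℝ≥0) * bernsteinExponent d μ (z j)) := by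
  have hm := fun j : Fin m => measurable_indicator_Ioc_mul (t j.castSucc) (t j.succ)
  have hsplit : ∀ ω, expNeg (∑ j, z j * subordinatorIncrement d (N ω) (t j.castSucc) (t j.succ)) =
      expNeg (∑ j, (t j.succ - t j.castSucc : ℝ≥0) * (d * z j)) *
      expNeg (∫⁻ p, ∑ j, z j * ((Set.Ioc (t j.castSucc : ℝ) (t j.succ)).indicator 1 p.1 * p.2)
        ∂(N ω)) := by
    intro ω
    rw [← expNeg_add, lintegral_finsetSum _ fun j _ => (hm j).const_mul _,
      ← Finset.sum_add_distrib]
    congr 1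
    refine Finset.sum_congr rfl fun j _ => ?_
    rw [lintegral_const_mul _ (hm j), subordinatorIncrement, mul_add]
    congr 1
    ring
  simp_rw [hsplit]
  have hf : Measurable fun p : ℝ × ℝ≥0∞ =>
      ∑ j, (z j : ℝ≥0∞) * ((Set.Ioc (t j.castSucc : ℝ) (t j.succ)).indicator 1 p.1 * p.2) :=
    Finset.measurable_sum _ fun j _ => (hm j).const_mul _
  have hfN : Measurable fun ω => ∫⁻ p, ∑ j, (z j : ℝ≥0∞) *
      ((Set.Ioc (t j.castSucc : ℝ) (t j.succ)).indicator 1 p.1 * p.2) ∂(N ω) :=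
    (Measure.measurable_lintegral hf).comp hN
  rw [lintegral_const_mul _ hfN.expNeg, hL _ hf, ← expNeg_add, ← expNeg_sum]
  simp_rw [one_sub_expNeg_sum_indicator (pairwise_disjoint_Ioc_of_monotone ht) z]
  have hg : ∀ j, Measurable fun r : ℝ≥0∞ => 1 - expNeg (z j * r) := fun j =>
    measurable_const.sub (measurable_const.mul measurable_id).expNeg
  have hi : ∀ j : Fin m, Measurable
      ((Set.Ioc (t j.castSucc : ℝ) (t j.succ)).indicator (1 : ℝ → ℝ≥0∞)) :=
    fun j => measurable_one.indicator measurableSet_Ioc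
  have hig : ∀ j : Fin m, Measurable fun p : ℝ × ℝ≥0∞ =>
      (Set.Ioc (t j.castSucc : ℝ) (t j.succ)).indicator (1 : ℝ → ℝ≥0∞) p.1 *
        (1 - expNeg (z j * p.2)) :=
    fun j => ((hi j).comp measurable_fst).mul ((hg j).comp measurable_snd)
  rw [lintegral_finsetSum _ fun j _ => hig j, ← Finset.sum_add_distrib]
  congr 1
  refine Finset.sum_congr rfl fun j _ => ?_
  rw [bernsteinExponent, mul_add, lintegral_prod_mul (hi j).aemeasurable (hg j).aemeasurable,
    lintegral_indicator_one measurableSet_Ioc, Real.volume_Ioc,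
    ← NNReal.coe_sub (ht (by simp [Fin.le_def])),
    ENNReal.ofReal_coe_nnreal]

/-- Markov's inequality for 1 - e^{-X_t}, which is at least 1 - e^{-ε} > 0 where X_t > ε. -/
lemma tendsto_measure_lt_of_tendsto_laplace {S ι : Type*} [MeasurableSpace S] {Q : Measure S}
    [IsProbabilityMeasure Q] {X : ι → S → ℝ≥0∞} (hX : ∀ t, Measurable (X t)) {l : Filter ι}
    (h : Tendsto (fun t => ∫⁻ ω, expNeg (X t ω) ∂Q) l (𝓝 1)) {ε : ℝ≥0∞} (hε : 0 < ε) :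
    Tendsto (fun t => Q {ω | ε < X t ω}) l (𝓝 0) := by
  have hε1 : 1 - expNeg ε ≠ 0 :=
    (tsub_pos_of_lt (expNeg_zero ▸ expNeg_strictAnti hε)).ne'
  have hε2 : 1 - expNeg ε ≠ ∞ := (tsub_le_self.trans_lt ENNReal.one_lt_top).ne
  have hb : ∀ t, Q {ω | ε < X t ω} ≤ (1 - ∫⁻ ω, expNeg (X t ω) ∂Q) / (1 - expNeg ε) := by
    intro t
    rw [ENNReal.le_div_iff_mul_le (.inl hε1) (.inl hε2), mul_comm,
      ← lintegral_one_sub_expNeg Q (hX t)]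
    have hm : Measurable fun ω => 1 - expNeg (X t ω) := measurable_const.sub (hX t).expNeg
    refine le_trans ?_ (mul_meas_ge_le_lintegral hm (1 - expNeg ε))
    refine mul_le_mul_right (measure_mono fun ω hω => ?_) _
    exact tsub_le_tsub_left (expNeg_strictAnti.antitone (le_of_lt hω)) _
  have hlim : Tendsto (fun t => (1 - ∫⁻ ω, expNeg (X t ω) ∂Q) / (1 - expNeg ε)) l (𝓝 0) := by
    have := ENNReal.Tendsto.div_const
      (ENNReal.Tendsto.sub (tendsto_const_nhds (x := (1 : ℝ≥0∞))) h (.inl ENNReal.one_ne_top))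
      (.inr hε1)
    simpa using this
  exact tendsto_of_tendsto_of_tendsto_of_le_of_le tendsto_const_nhds hlim
    (fun _ => zero_le) hb

lemma measurable_subordinatorIncrement {S : Type*} [MeasurableSpace S]
    {N : S → Measure (ℝ × ℝ≥0∞)} (hN : Measurable N) (d s t : ℝ≥0) :
    Measurable fun ω => subordinatorIncrement d (N ω) s t :=
  measurable_const.add
    ((Measure.measurable_lintegral (measurable_indicator_Ioc_mul _ _)).comp hN)

theorem isLevyProcessOf_subordinator {S : Type*} [MeasurableSpace S] {Q : Measure S}
    [IsProbabilityMeasure Q] {μ : Measure ℝ≥0∞} [SFinite μ] {N : S → Measure (ℝ × ℝ≥0∞)}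
    (hN : Measurable N)
    (hL : ∀ f : ℝ × ℝ≥0∞ → ℝ≥0∞, Measurable f → ∫⁻ ω, expNeg (∫⁻ x, f x ∂(N ω)) ∂Q =
      expNeg (∫⁻ x, (1 - expNeg (f x)) ∂((volume : Measure ℝ).prod μ)))
    (d : ℝ≥0) {G : ℝ≥0 → ℝ} (hG0 : ∀ z, 0 ≤ G z)
    (hG : ∀ z, bernsteinExponent d μ z = ENNReal.ofReal (G z)) :
    GSampler.IsLevyProcessOf Q (fun t ω => subordinatorIncrement d (N ω) 0 t) G := by
  have hX := fun t => measurable_subordinatorIncrement hN d 0 t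
  have hlap : ∀ t z : ℝ≥0, ∫⁻ ω, expNeg (z * subordinatorIncrement d (N ω) 0 t) ∂Q =
      expNeg (t * bernsteinExponent d μ z) := by
    intro t z
    have hmono : Monotone ![0, t] := by
      intro i j hij
      fin_cases i <;> fin_cases j <;> simp_all
    simpa using lintegral_expNeg_sum_subordinatorIncrement hN hL d hmono (fun _ => z)
  have hlap' : GSampler.HasLaplaceExponent Q (fun t ω => subordinatorIncrement d (N ω) 0 t) G := by
    intro t z
    refine (hlap t z).trans ?_
    rw [hG, ← ENNReal.ofReal_coe_nnreal, ← ENNReal.ofReal_mul t.coe_nonneg,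
      expNeg_ofReal (mul_nonneg t.coe_nonneg (hG0 z))]
  refine ⟨inferInstance, ⟨hX, fun m t ht h0 => ?_, ?_, fun ε hε => ?_⟩, hlap'⟩
  · have hprob : ∀ t, IsProbabilityMeasure
        (Q.map fun ω => subordinatorIncrement d (N ω) 0 t) := fun t =>
      Measure.isProbabilityMeasure_map (hX t).aemeasurable
    have hD : Measurable fun ω (j : Fin m) =>
        subordinatorIncrement d (N ω) (t j.castSucc) (t j.succ) :=
      measurable_pi_lambda _ fun j => measurable_subordinatorIncrement hN d _ _
    -- The increments are independent with stationary laws because the two Laplace transforms agree;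
    -- taking partial sums then recovers the process.
    have hlaw : Q.map (fun ω (j : Fin m) =>
        subordinatorIncrement d (N ω) (t j.castSucc) (t j.succ)) =
        Measure.pi fun j : Fin m => Q.map fun ω =>
          subordinatorIncrement d (N ω) 0 (t j.succ - t j.castSucc) := by
      have : IsProbabilityMeasure (Q.map fun ω (j : Fin m) =>
        subordinatorIncrement d (N ω) (t j.castSucc) (t j.succ)) :=
        Measure.isProbabilityMeasure_map hD.aemeasurable
      refine ext_of_laplace fun z => ?_
      have hz : Measurable fun x : Fin m → ℝ≥0∞ => ∑ i, (z i : ℝ≥0∞) * x i := by fun_prop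
      rw [lintegral_pi_expNeg_sum, lintegral_map hz.expNeg hD,
        lintegral_expNeg_sum_subordinatorIncrement hN hL d ht]
      refine Finset.prod_congr rfl fun j _ => ?_
      have hzj : Measurable fun x : ℝ≥0∞ => (z j : ℝ≥0∞) * x := by fun_prop
      rw [lintegral_map hzj.expNeg (hX _)]
      exact (hlap _ _).symm
    rw [← hlaw, Measure.map_map (measurable_pi_lambda _ fun i =>
      Finset.measurable_sum _ fun j _ => measurable_pi_apply j) hD]
    congr 1
    funext ω i
    simp only [Function.comp_apply]
    rw [sum_subordinatorIncrement d (N ω) ht i, h0]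
  · exact .of_forall fun ω => subordinatorIncrement_self d (N ω) 0
  · refine tendsto_measure_lt_of_tendsto_laplace hX ?_ hε
    have hc : ContinuousAt (fun t : ℝ≥0 => ENNReal.ofReal (Real.exp (-((t : ℝ) * G 1)))) 0 :=
      (ENNReal.continuous_ofReal.comp (by fun_prop)).continuousAt
    have h1 : ∀ t : ℝ≥0, ∫⁻ ω, expNeg (subordinatorIncrement d (N ω) 0 t) ∂Q =
        ENNReal.ofReal (Real.exp (-((t : ℝ) * G 1))) := by
      intro t
      rw [← hlap' t 1]
      simp [expNeg]
    simp_rw [h1]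
    simpa using hc.tendsto.mono_left nhdsWithin_le_nhds

/-! ### Realising the class `𝒢` by subordinators. -/

/-- Provides integrability of the Bernstein integrand, without which the Bochner integral in the
class would take its default value 0. -/
lemma one_sub_exp_neg_mul_le {r : ℝ} (hr : 0 < r) (z : ℝ) :
    1 - Real.exp (-(r * z)) ≤ max z 1 * min r 1 := by
  have h1 : 1 - Real.exp (-(r * z)) ≤ r * z := by linarith [Real.add_one_le_exp (-(r * z))]
  have h2 : 1 - Real.exp (-(r * z)) ≤ 1 := by linarith [Real.exp_pos (-(r * z))]
  rcases le_total r 1 with h | h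
  · rw [min_eq_left h]
    nlinarith [le_max_left z 1]
  · rw [min_eq_right h]
    linarith [le_max_right z 1]

/-- With density `f` the measure becomes finite, and dividing by `f` recovers it. Applied to
min(r,1), this supplies the s-finiteness that the definition of the class does not state. -/
lemma sfinite_of_lintegral_ne_top {α : Type*} [MeasurableSpace α] {μ : Measure α} {f : α → ℝ≥0∞}
    (hf : Measurable f) (h0 : ∀ᵐ x ∂μ, f x ≠ 0) (hint : ∫⁻ x, f x ∂μ ≠ ∞) : SFinite μ := by
  have : IsFiniteMeasure (μ.withDensity f) := isFiniteMeasure_withDensity hint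
  rw [← withDensity_inv_same hf h0
    ((ae_lt_top hf hint).mono fun x hx => hx.ne)]
  infer_instance

/-- Every function of the class `𝒢` is the exponent of a subordinator, whose Lévy measure charges
`∞` with the killing rate. -/
theorem exists_bernsteinExponent_eq {G : ℝ≥0 → ℝ} (hG : G ∈ GSampler.ClassG) :
    ∃ (d : ℝ≥0) (μ : Measure ℝ≥0∞), SFinite μ ∧
      ∀ z, 0 ≤ G z ∧ bernsteinExponent d μ z = ENNReal.ofReal (G z) := by
  obtain ⟨c, d, ν, hν, hGz⟩ := hG
  have hmin : Measurable fun r : ℝ => ENNReal.ofReal (min r 1) := by fun_prop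
  have hs : SFinite (ν.restrict (Set.Ioi 0)) :=
    sfinite_of_lintegral_ne_top hmin ((ae_restrict_mem measurableSet_Ioi).mono fun r hr => by
      simpa using hr) hν.ne
  -- A jump of size ∞ contributes 1 - e^{-z·∞} = 1[z > 0], so the atom at ∞ with mass `c` produces
  -- the killing term.
  refine ⟨d, (ν.restrict (Set.Ioi 0)).map ENNReal.ofReal + c • Measure.dirac ∞, inferInstance,
    fun z => ?_⟩
  have hnn : ∀ r ∈ Set.Ioi (0 : ℝ), 0 ≤ 1 - Real.exp (-(r * z)) := fun r hr => by
    have : Real.exp (-(r * z)) ≤ 1 :=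
      Real.exp_le_one_iff.2 (neg_nonpos.2 (mul_nonneg (le_of_lt hr) z.coe_nonneg))
    linarith
  have hint : Integrable (fun r : ℝ => 1 - Real.exp (-(r * z))) (ν.restrict (Set.Ioi 0)) := by
    refine ⟨by fun_prop, ?_⟩
    rw [hasFiniteIntegral_iff_ofReal ((ae_restrict_mem measurableSet_Ioi).mono hnn)]
    calc ∫⁻ r in Set.Ioi (0 : ℝ), ENNReal.ofReal (1 - Real.exp (-(r * z))) ∂ν
        ≤ ∫⁻ r in Set.Ioi (0 : ℝ),
          ENNReal.ofReal (max (z : ℝ) 1) * ENNReal.ofReal (min r 1) ∂ν := by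
          refine setLIntegral_mono (hmin.const_mul _) fun r hr => ?_
          rw [← ENNReal.ofReal_mul (by positivity)]
          exact ENNReal.ofReal_le_ofReal (one_sub_exp_neg_mul_le hr z)
      _ < ∞ := by
          rw [lintegral_const_mul _ hmin]
          exact ENNReal.mul_lt_top ENNReal.ofReal_lt_top hν
  have hI : 0 ≤ ∫ r in Set.Ioi (0 : ℝ), (1 - Real.exp (-(r * (z : ℝ)))) ∂ν :=
    setIntegral_nonneg measurableSet_Ioi hnn
  have hc : 0 ≤ (c : ℝ) * (if 0 < z then 1 else 0) := by positivity
  have hm : Measurable fun r : ℝ≥0∞ => 1 - expNeg (z * r) :=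
    measurable_const.sub (measurable_const.mul measurable_id).expNeg
  refine ⟨by rw [hGz]; positivity, ?_⟩
  rw [bernsteinExponent, hGz, lintegral_add_measure, lintegral_map hm ENNReal.measurable_ofReal,
    lintegral_smul_measure, lintegral_dirac' _ hm, ENNReal.ofReal_add (by positivity) hI,
    ENNReal.ofReal_add hc (by positivity),
    ofReal_integral_eq_lintegral_ofReal hint ((ae_restrict_mem measurableSet_Ioi).mono hnn)]
  have h1 : ∫⁻ r in Set.Ioi (0 : ℝ), (1 - expNeg (z * ENNReal.ofReal r)) ∂ν =
      ∫⁻ r in Set.Ioi (0 : ℝ), ENNReal.ofReal (1 - Real.exp (-(r * z))) ∂ν := by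
    refine setLIntegral_congr_fun measurableSet_Ioi fun r hr => ?_
    have hr' : 0 ≤ r := le_of_lt hr
    rw [← ENNReal.ofReal_coe_nnreal, ← ENNReal.ofReal_mul z.coe_nonneg,
      expNeg_ofReal (by positivity), ENNReal.ofReal_sub _ (Real.exp_nonneg _), ENNReal.ofReal_one,
      mul_comm]
  have h2 : c • (1 - expNeg (z * ∞)) = ENNReal.ofReal ((c : ℝ) * (if 0 < z then 1 else 0)) := by
    rcases eq_or_lt_of_le (zero_le (a := z)) with h | h
    · simp [← h, expNeg_zero]
    · simp [h, h.ne', expNeg_top, ENNReal.mul_top, ENNReal.smul_def]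
  have h3 : (d : ℝ≥0∞) * z = ENNReal.ofReal (d * z) := by
    rw [ENNReal.ofReal_mul d.coe_nonneg, ENNReal.ofReal_coe_nnreal, ENNReal.ofReal_coe_nnreal]
  rw [h1, h2, h3]
  ring

theorem exists_isLevyProcessOf {G : ℝ≥0 → ℝ} (hG : G ∈ GSampler.ClassG) :
    ∃ (S : Type) (_ : MeasurableSpace S) (Q : Measure S) (X : ℝ≥0 → S → ℝ≥0∞),
      GSampler.IsLevyProcessOf Q X G := by
  obtain ⟨d, μ, _, h⟩ := exists_bernsteinExponent_eq hG
  obtain ⟨S, _, Q, N, _, hN, hL⟩ := exists_poissonRandomMeasure ((volume : Measure ℝ).prod μ)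
  exact ⟨S, _, Q, _, isLevyProcessOf_subordinator hN hL d (fun z => (h z).1) fun z => (h z).2⟩

/-! ### Monotonicity in time and the level function. -/

/-- Paths are not assumed monotone. In law, however, (X_s, X_t) is a pair of partial sums of
nonnegative variables, which is ordered pointwise. -/
lemma measure_le_mono_of_isNonnegLevyProcess {S : Type*} [MeasurableSpace S] {Q : Measure S}
    {X : ℝ≥0 → S → ℝ≥0∞} (hX : GSampler.IsNonnegLevyProcess Q X)
    (a : ℝ≥0∞) {s t : ℝ≥0} (hst : s ≤ t) : Q {ω | a ≤ X s ω} ≤ Q {ω | a ≤ X t ω} := by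
  have hmono : Monotone ![0, s, t] := by
    intro i j hij
    fin_cases i <;> fin_cases j <;> simp_all
  have h := hX.increments 2 ![0, s, t] hmono rfl
  set ρ := Measure.pi fun i : Fin 2 =>
    Q.map (X ((![0, s, t] : Fin 3 → ℝ≥0) i.succ - (![0, s, t] : Fin 3 → ℝ≥0) i.castSucc))
  have hpart : Measurable fun (ξ : Fin 2 → ℝ≥0∞) (i : Fin 2) => ∑ j ∈ Finset.Iic i, ξ j :=
    measurable_pi_lambda _ fun i => Finset.measurable_sum _ fun j _ => measurable_pi_apply j
  have hvec : Measurable fun ω (i : Fin 2) => X ((![0, s, t] : Fin 3 → ℝ≥0) i.succ) ω :=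
    measurable_pi_lambda _ fun i => hX.measurable _
  have key : ∀ i : Fin 2, Q {ω | a ≤ X ((![0, s, t] : Fin 3 → ℝ≥0) i.succ) ω} =
      ρ {ξ | a ≤ ∑ j ∈ Finset.Iic i, ξ j} := by
    intro i
    have hm : MeasurableSet {x : Fin 2 → ℝ≥0∞ | a ≤ x i} :=
      measurableSet_le measurable_const (measurable_pi_apply i)
    have := congrArg (fun m => m {x : Fin 2 → ℝ≥0∞ | a ≤ x i}) h
    rwa [Measure.map_apply hvec hm, Measure.map_apply hpart hm] at this
  have h0 := key 0
  have h1 := key 1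
  simp only [Fin.succ_zero_eq_one, Matrix.cons_val_one, Matrix.cons_val_zero] at h0
  simp only [Fin.succ_one_eq_two, Matrix.cons_val] at h1
  rw [h0, h1]
  have hsub : ∀ ξ : Fin 2 → ℝ≥0∞, ∑ j ∈ Finset.Iic 0, ξ j ≤ ∑ j ∈ Finset.Iic 1, ξ j := fun ξ =>
    Finset.sum_le_sum_of_subset (Finset.Iic_subset_Iic.2 (Fin.zero_le _))
  exact measure_mono fun ξ (hξ : a ≤ _) => hξ.trans (hsub ξ)

section LevelFunction

variable {S : Type*} [MeasurableSpace S] {Q : Measure S} {X : ℝ≥0 → S → ℝ≥0∞}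

lemma levelFunction_le {a b : ℝ} {t : ℝ≥0}
    (h : ENNReal.ofReal b ≤ Q {ω | ENNReal.ofReal a ≤ X t ω}) :
    GSampler.levelFunction Q X a b ≤ t :=
  iInf₂_le t h

/-- Some admissible time lies below `t`, and monotonicity carries admissibility up to `t`.
Strictness is used because the infimum need not be attained. -/
lemma le_measure_of_levelFunction_lt (hX : GSampler.IsNonnegLevyProcess Q X) {a b : ℝ} {t : ℝ≥0}
    (h : GSampler.levelFunction Q X a b < t) :
    ENNReal.ofReal b ≤ Q {ω | ENNReal.ofReal a ≤ X t ω} := by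
  simp only [GSampler.levelFunction, iInf_lt_iff] at h
  obtain ⟨s, hs, hst⟩ := h
  exact hs.trans (measure_le_mono_of_isNonnegLevyProcess hX _ (ENNReal.coe_lt_coe.1 hst).le)

lemma measurable_measure_ofReal_le (t : ℝ≥0) :
    Measurable fun a : ℝ => Q {ω | ENNReal.ofReal a ≤ X t ω} := by
  refine Antitone.measurable fun a b hab => measure_mono fun ω hω => ?_
  exact (ENNReal.ofReal_le_ofReal hab).trans hω

/-- By monotonicity in time, rational times suffice to describe the sublevel sets. -/
lemma measurable_levelFunction (hX : GSampler.IsNonnegLevyProcess Q X) :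
    Measurable fun p : ℝ × ℝ => GSampler.levelFunction Q X p.1 p.2 := by
  refine measurable_of_Iio fun c => ?_
  have : (fun p : ℝ × ℝ => GSampler.levelFunction Q X p.1 p.2) ⁻¹' Set.Iio c =
      ⋃ (q : ℚ) (_ : (Real.toNNReal q : ℝ≥0∞) < c),
        {p : ℝ × ℝ | ENNReal.ofReal p.2 ≤
          Q {ω | ENNReal.ofReal p.1 ≤ X (Real.toNNReal q) ω}} := by
    ext p
    simp only [Set.mem_preimage, Set.mem_Iio, Set.mem_iUnion, Set.mem_ofPred_eq, exists_prop]
    constructor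
    · intro h
      obtain ⟨q, _, hq, hqc⟩ := ENNReal.lt_iff_exists_rat_btwn.1 h
      exact ⟨q, hqc, le_measure_of_levelFunction_lt hX hq⟩
    · rintro ⟨q, hqc, hq⟩
      exact (levelFunction_le hq).trans_lt hqc
  rw [this]
  refine MeasurableSet.iUnion fun q => MeasurableSet.iUnion fun _ => ?_
  exact measurableSet_le (ENNReal.measurable_ofReal.comp measurable_snd)
    ((measurable_measure_ofReal_le _).comp measurable_fst)

end LevelFunction

/-! ### The tail of the least level, and exponential races. -/

/-- A uniform variable exceeds `p` with probability `1 - p`. -/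
lemma volume_restrict_Icc_lt_ofReal {p : ℝ≥0∞} (hp : p ≤ 1) :
    volume.restrict (Set.Icc (0 : ℝ) 1) {u | p < ENNReal.ofReal u} = 1 - p := by
  have hm : MeasurableSet {u : ℝ | p < ENNReal.ofReal u} :=
    measurableSet_lt measurable_const ENNReal.measurable_ofReal
  rw [Measure.restrict_apply hm]
  lift p to ℝ≥0 using (hp.trans_lt ENNReal.one_lt_top).ne
  have : {u : ℝ | (p : ℝ≥0∞) < ENNReal.ofReal u} ∩ Set.Icc 0 1 = Set.Ioc (p : ℝ) 1 := by
    ext u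
    simp only [Set.mem_inter_iff, Set.mem_ofPred_eq, Set.mem_Icc, Set.mem_Ioc]
    constructor
    · rintro ⟨h1, _, h3⟩
      refine ⟨?_, h3⟩
      rwa [ENNReal.lt_ofReal_iff_toReal_lt ENNReal.coe_ne_top] at h1
    · rintro ⟨h1, h2⟩
      refine ⟨?_, p.coe_nonneg.trans h1.le, h2⟩
      rwa [ENNReal.lt_ofReal_iff_toReal_lt ENNReal.coe_ne_top]
  rw [this, Real.volume_Ioc, ENNReal.ofReal_sub _ p.coe_nonneg, ENNReal.ofReal_one,
    ENNReal.ofReal_coe_nnreal]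

/-- Only the smallest threshold matters on either side, and a uniform exceeds q with probability 1 -
q. This exchanges the hash value for a copy of the process value. -/
lemma volume_restrict_Icc_forall_measure_lt {S : Type*} [MeasurableSpace S] {Q : Measure S}
    [IsProbabilityMeasure Q] {Z : S → ℝ≥0∞} (hZ : Measurable Z) {ι : Type*} [Finite ι]
    (a : ι → ℝ) :
    volume.restrict (Set.Icc (0 : ℝ) 1)
      {u | ∀ i, Q {ω | ENNReal.ofReal (a i) ≤ Z ω} < ENNReal.ofReal u} =
      Q {ω | ∀ i, Z ω < ENNReal.ofReal (a i)} := by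
  cases isEmpty_or_nonempty ι with
  | inl h => simp
  | inr h =>
    obtain ⟨i₀, hi₀⟩ := Finite.exists_min a
    have h1 : {u : ℝ | ∀ i, Q {ω | ENNReal.ofReal (a i) ≤ Z ω} < ENNReal.ofReal u} =
        {u : ℝ | Q {ω | ENNReal.ofReal (a i₀) ≤ Z ω} < ENNReal.ofReal u} := by
      ext u
      refine ⟨fun hu => hu i₀, fun hu i => lt_of_le_of_lt (measure_mono fun ω hω => ?_) hu⟩
      exact (ENNReal.ofReal_le_ofReal (hi₀ i)).trans hω
    have h2 : {ω | ∀ i, Z ω < ENNReal.ofReal (a i)} = {ω | ENNReal.ofReal (a i₀) ≤ Z ω}ᶜ := by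
      ext ω
      simp only [Set.mem_ofPred_eq, Set.mem_compl_iff, not_le]
      exact ⟨fun h => h i₀, fun h i => h.trans_le (ENNReal.ofReal_le_ofReal (hi₀ i))⟩
    rw [h1, h2, volume_restrict_Icc_lt_ofReal prob_le_one,
      prob_compl_eq_one_sub (measurableSet_le measurable_const hZ)]

lemma expMeasure_Ioi {r x : ℝ} (hr : 0 < r) (hx : 0 ≤ x) :
    expMeasure r (Set.Ioi x) = ENNReal.ofReal (Real.exp (-(r * x))) := by
  have := isProbabilityMeasure_expMeasure hr
  rw [← Set.compl_Iic, prob_compl_eq_one_sub measurableSet_Iic, ← ofReal_cdf,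
    cdf_expMeasure_eq hr, if_pos hx, ← ENNReal.ofReal_one, ← ENNReal.ofReal_sub]
  · congr 1; ring
  · rw [sub_nonneg, Real.exp_le_one_iff]
    nlinarith

lemma expMeasure_one_lt_ofReal_div (x : ℝ≥0∞) {Δ : ℝ≥0} (hΔ : 0 < Δ) :
    expMeasure 1 {y | x < ENNReal.ofReal (y / Δ)} = expNeg (Δ * x) := by
  induction x with
  | top => simp [ENNReal.mul_top, hΔ.ne', expNeg_top]
  | coe x =>
    have : {y : ℝ | (x : ℝ≥0∞) < ENNReal.ofReal (y / Δ)} = Set.Ioi ((Δ * x : ℝ≥0) : ℝ) := by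
      ext y
      rw [Set.mem_ofPred_eq, ENNReal.lt_ofReal_iff_toReal_lt ENNReal.coe_ne_top,
        ENNReal.coe_toReal, lt_div_iff₀ (NNReal.coe_pos.2 hΔ), Set.mem_Ioi, NNReal.coe_mul,
        mul_comm]
    rw [this, expMeasure_Ioi one_pos NNReal.zero_le_coe, ← ENNReal.coe_mul, expNeg_coe, one_mul]

/-- The survival function of the level, up to the boundary case. -/
lemma prod_uniform_expMeasure_forall_lt {S : Type*} [MeasurableSpace S] {Q : Measure S}
    {X : ℝ≥0 → S → ℝ≥0∞} {G : ℝ≥0 → ℝ} (hX : GSampler.IsLevyProcessOf Q X G) {ι : Type*}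
    [Fintype ι] {Δ : ι → ℝ≥0} (hΔ : ∀ i, 0 < Δ i) (t : ℝ≥0) :
    ((volume.restrict (Set.Icc (0 : ℝ) 1)).prod (Measure.pi fun _ : ι => expMeasure 1))
      {p | ∀ i, Q {ω | ENNReal.ofReal (p.2 i / Δ i) ≤ X t ω} < ENNReal.ofReal p.1} =
      ENNReal.ofReal (Real.exp (-(t * G (∑ i, Δ i)))) := by
  have := hX.isProbabilityMeasure
  have := isProbabilityMeasure_expMeasure one_pos
  have hXm := hX.isNonnegLevyProcess.measurable t
  have hm1 : MeasurableSet {p : ℝ × (ι → ℝ) |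
      ∀ i, Q {ω | ENNReal.ofReal (p.2 i / Δ i) ≤ X t ω} < ENNReal.ofReal p.1} := by
    rw [Set.ofPred_forall]
    refine MeasurableSet.iInter fun i => measurableSet_lt ?_
      (ENNReal.measurable_ofReal.comp measurable_fst)
    exact (measurable_measure_ofReal_le (Q := Q) (X := X) t).comp
      (((measurable_pi_apply i).comp measurable_snd).div_const _)
  have hm2 : MeasurableSet {p : S × (ι → ℝ) | ∀ i, X t p.1 < ENNReal.ofReal (p.2 i / Δ i)} := by
    rw [Set.ofPred_forall]
    refine MeasurableSet.iInter fun i => measurableSet_lt (hXm.comp measurable_fst) ?_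
    exact ENNReal.measurable_ofReal.comp
      (((measurable_pi_apply i).comp measurable_snd).div_const _)
  have h1 : ∀ ω, Measure.pi (fun _ : ι => expMeasure 1)
      {y | ∀ i, X t ω < ENNReal.ofReal (y i / Δ i)} = expNeg ((∑ i, Δ i : ℝ≥0) * X t ω) := by
    intro ω
    have : {y : ι → ℝ | ∀ i, X t ω < ENNReal.ofReal (y i / Δ i)} =
        Set.univ.pi fun i => {y | X t ω < ENNReal.ofReal (y / Δ i)} := by
      ext y; simp
    rw [this, Measure.pi_pi, ENNReal.ofNNReal_finsetSum, Finset.sum_mul, expNeg_sum]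
    exact Finset.prod_congr rfl fun i _ => expMeasure_one_lt_ofReal_div _ (hΔ i)
  -- Integrate out the uniform for fixed clocks, then use Fubini to integrate out the clocks for a
  -- fixed process value.
  calc _ = ∫⁻ y, Q {ω | ∀ i, X t ω < ENNReal.ofReal (y i / Δ i)}
        ∂(Measure.pi fun _ : ι => expMeasure 1) := by
        rw [Measure.prod_apply_symm hm1]
        exact lintegral_congr fun y =>
          volume_restrict_Icc_forall_measure_lt hXm fun i => y i / Δ i
    _ = ∫⁻ ω, expNeg ((∑ i, Δ i : ℝ≥0) * X t ω) ∂Q := by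
        simp_rw [← h1]
        exact (Measure.prod_apply_symm hm2).symm.trans (Measure.prod_apply hm2)
    _ = _ := hX.hasLaplaceExponent t _

lemma map_eq_map_expMeasure {Ω : Type*} [MeasurableSpace Ω] {P : Measure Ω}
    [IsProbabilityMeasure P] {Z : Ω → ℝ≥0∞} (hZ : Measurable Z) {g : ℝ} (hg : 0 < g)
    (h : ∀ t : ℝ≥0, P {ω | (t : ℝ≥0∞) < Z ω} = ENNReal.ofReal (Real.exp (-(t * g)))) :
    P.map Z = (expMeasure g).map ENNReal.ofReal := by
  have := isProbabilityMeasure_expMeasure hg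
  have := Measure.isProbabilityMeasure_map (μ := P) hZ.aemeasurable
  have := Measure.isProbabilityMeasure_map (μ := expMeasure g)
    ENNReal.measurable_ofReal.aemeasurable
  refine Measure.ext_of_Iic _ _ fun a => ?_
  induction a with
  | top => simp
  | coe t =>
    rw [← Set.compl_Ioi, prob_compl_eq_one_sub measurableSet_Ioi,
      prob_compl_eq_one_sub measurableSet_Ioi, Measure.map_apply hZ measurableSet_Ioi,
      Measure.map_apply ENNReal.measurable_ofReal measurableSet_Ioi]
    have h1 : ENNReal.ofReal ⁻¹' Set.Ioi (t : ℝ≥0∞) = Set.Ioi (t : ℝ) := by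
      ext y
      rw [Set.mem_preimage, Set.mem_Ioi, ENNReal.lt_ofReal_iff_toReal_lt ENNReal.coe_ne_top]
      rfl
    rw [h1, expMeasure_Ioi hg t.coe_nonneg, mul_comm]
    exact congrArg _ (h t)

/-- Tilting the density of rate `g` by e^{-by} gives g/(g+b) times the density of rate g+b. -/
lemma lintegral_exp_neg_mul_expMeasure {g b : ℝ} (hg : 0 < g) (hb : 0 ≤ b) :
    ∫⁻ y, ENNReal.ofReal (Real.exp (-(y * b))) ∂(expMeasure g) = ENNReal.ofReal (g / (g + b)) := by
  have hgb : 0 < g + b := by positivity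
  have h1 : ∀ y, exponentialPDF g y * ENNReal.ofReal (Real.exp (-(y * b))) =
      ENNReal.ofReal (g / (g + b)) * exponentialPDF (g + b) y := by
    intro y
    rw [exponentialPDF_eq, exponentialPDF_eq, ← ENNReal.ofReal_mul (by split_ifs <;> positivity),
      ← ENNReal.ofReal_mul (by positivity)]
    congr 1
    split_ifs
    · rw [mul_assoc, ← Real.exp_add]
      field_simp
      ring_nf
    · simp
  have h2 : expMeasure g = volume.withDensity (exponentialPDF g) := rfl
  have h3 : ∀ r, Measurable (exponentialPDF r) := fun r =>
    (measurable_exponentialPDFReal r).ennreal_ofReal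
  rw [h2, lintegral_withDensity_eq_lintegral_mul _ (h3 g) (by fun_prop)]
  simp only [Pi.mul_apply, h1]
  rw [lintegral_const_mul _ (h3 _), lintegral_exponentialPDF_eq_one hgb, mul_one]

/-- The probability that an exponential clock rings first. -/
lemma measure_lt_of_indepFun_exponential {Ω : Type*} [MeasurableSpace Ω] {P : Measure Ω}
    [IsProbabilityMeasure P] {Z W : Ω → ℝ≥0∞} (hZ : Measurable Z) (hW : Measurable W)
    (hind : IndepFun Z W P) {g b : ℝ} (hg : 0 < g) (hb : 0 ≤ b)
    (hZt : ∀ t : ℝ≥0, P {ω | (t : ℝ≥0∞) < Z ω} = ENNReal.ofReal (Real.exp (-(t * g))))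
    (hWt : ∀ t : ℝ≥0, P {ω | (t : ℝ≥0∞) < W ω} = ENNReal.ofReal (Real.exp (-(t * b)))) :
    P {ω | Z ω < W ω} = ENNReal.ofReal (g / (g + b)) := by
  have hm : MeasurableSet {p : ℝ≥0∞ × ℝ≥0∞ | p.1 < p.2} :=
    measurableSet_lt measurable_fst measurable_snd
  have := Measure.isProbabilityMeasure_map (μ := P) hW.aemeasurable
  have h1 : P {ω | Z ω < W ω} = P.map (fun ω => (Z ω, W ω)) {p | p.1 < p.2} := by
    rw [Measure.map_apply (hZ.prodMk hW) hm]; rfl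
  have h2 : Measurable fun x => P.map W (Prod.mk x ⁻¹' {p : ℝ≥0∞ × ℝ≥0∞ | p.1 < p.2}) :=
    measurable_measure_prodMk_left hm
  rw [h1, (indepFun_iff_map_prod_eq_prod_map_map hZ.aemeasurable hW.aemeasurable).1 hind,
    Measure.prod_apply hm, map_eq_map_expMeasure hZ hg hZt,
    lintegral_map h2 ENNReal.measurable_ofReal, ← lintegral_exp_neg_mul_expMeasure hg hb]
  have hpos : ∀ᵐ y ∂(expMeasure g), 0 < y := by
    have := isProbabilityMeasure_expMeasure hg
    refine (mem_ae_iff_prob_eq_one measurableSet_Ioi).2 ?_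
    rw [expMeasure_Ioi hg le_rfl]
    simp
  refine lintegral_congr_ae (hpos.mono fun y hy => ?_)
  simp only
  rw [Measure.map_apply hW (measurable_prodMk_left hm)]
  lift y to ℝ≥0 using hy.le
  rw [← hWt, ENNReal.ofReal_coe_nnreal]
  rfl

/-! ### Deterministic behaviour of the sampler. -/

section Run

variable {n : ℕ} (ℓ : ℝ → ℝ → ℝ≥0∞) (v : ℕ → Fin n) (Δ : ℕ → ℝ≥0) (H : Fin n → ℝ) (Y : ℕ → ℝ)

lemma run_snd (k : ℕ) : (GSampler.run ℓ v Δ H Y k).2 =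
    (Finset.range k).inf fun i => ℓ (Y i / Δ i) (H (v i)) := by
  induction k with
  | zero => rfl
  | succ k ih =>
    rw [Finset.range_add_one, Finset.inf_insert, ← ih, GSampler.run, GSampler.update]
    split_ifs with h
    · exact (inf_eq_left.2 h.le).symm
    · exact (inf_eq_right.2 (not_lt.1 h)).symm

lemma exists_of_run_fst_eq_some (k : ℕ) {w : Fin n}
    (h : (GSampler.run ℓ v Δ H Y k).1 = some w) :
    ∃ i < k, v i = w ∧ ℓ (Y i / Δ i) (H (v i)) = (GSampler.run ℓ v Δ H Y k).2 := by
  induction k with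
  | zero => simp [GSampler.run] at h
  | succ k ih =>
    rw [GSampler.run, GSampler.update] at h ⊢
    split_ifs at h ⊢ with hlt
    · exact ⟨k, k.lt_succ_self, by simpa using h, rfl⟩
    · obtain ⟨i, hi, hv, hh⟩ := ih h
      exact ⟨i, hi.trans k.lt_succ_self, hv, hh⟩

lemma run_snd_eq_top_of_fst_eq_none (k : ℕ) (h : (GSampler.run ℓ v Δ H Y k).1 = none) :
    (GSampler.run ℓ v Δ H Y k).2 = ∞ := by
  induction k with
  | zero => rfl
  | succ k ih =>
    rw [GSampler.run, GSampler.update] at h ⊢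
    split_ifs at h ⊢
    exact ih h

/-- The minimum of the levels of the updates to coordinates in `W`. The randomness `z` consists of
the hash values and of the fresh random numbers. -/
noncomputable def minLevel (k : ℕ) (W : Finset (Fin n)) (z : Fin n ⊕ ℕ → ℝ) : ℝ≥0∞ :=
  {i ∈ Finset.range k | v i ∈ W}.inf fun i => ℓ (z (.inr i) / Δ i) (z (.inl (v i)))

/-- The coordinates on which the levels of the updates to coordinates in `W` depend. -/
def levelSupport (k : ℕ) (W : Finset (Fin n)) : Finset (Fin n ⊕ ℕ) :=
  W.disjSum {i ∈ Finset.range k | v i ∈ W}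

lemma dependsOn_minLevel (k : ℕ) (W : Finset (Fin n)) :
    DependsOn (minLevel ℓ v Δ k W) (levelSupport v k W : Set (Fin n ⊕ ℕ)) := by
  intro x y hxy
  refine Finset.inf_congr rfl fun i hi => ?_
  have hv := (Finset.mem_filter.1 hi).2
  rw [hxy (.inr i) (by simpa [levelSupport] using hi), hxy (.inl (v i)) (by simpa [levelSupport])]

lemma disjoint_levelSupport (k : ℕ) {W W' : Finset (Fin n)} (h : Disjoint W W') :
    Disjoint (levelSupport v k W) (levelSupport v k W') := by
  rw [Finset.disjoint_left] at h ⊢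
  rintro (w | i)
  · simpa [levelSupport] using @h w
  · simp only [levelSupport, Finset.inr_mem_disjSum, Finset.mem_filter, not_and]
    exact fun hi _ => h hi.2

variable {ℓ} in
lemma measurable_minLevel (hℓ : Measurable fun p : ℝ × ℝ => ℓ p.1 p.2) (k : ℕ)
    (W : Finset (Fin n)) : Measurable (minLevel ℓ v Δ k W) := by
  unfold minLevel
  simp only [Finset.inf_eq_iInf]
  refine Measurable.iInf fun i => Measurable.iInf fun _ => ?_
  have hz : Measurable fun z : Fin n ⊕ ℕ → ℝ => (z (.inr i) / Δ i, z (.inl (v i))) :=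
    ((measurable_pi_apply _).div_const _).prodMk (measurable_pi_apply _)
  exact hℓ.comp hz

lemma minLevel_union (k : ℕ) (W W' : Finset (Fin n)) (z : Fin n ⊕ ℕ → ℝ) :
    minLevel ℓ v Δ k (W ∪ W') z = minLevel ℓ v Δ k W z ⊓ minLevel ℓ v Δ k W' z := by
  rw [minLevel, minLevel, minLevel, ← Finset.inf_union, ← Finset.filter_or]
  simp only [Finset.mem_union]

lemma run_snd_eq_minLevel (k : ℕ) :
    (GSampler.run ℓ v Δ H Y k).2 = minLevel ℓ v Δ k Finset.univ (Sum.elim H Y) := by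
  simp [run_snd, minLevel]

/-- A strict win makes the stored minimum finite, which rules out `none`, and smaller than every
level of another coordinate, which rules out any other winner. -/
lemma run_fst_eq_some_of_minLevel_lt (k : ℕ) {w : Fin n}
    (h : minLevel ℓ v Δ k {w} (Sum.elim H Y) < minLevel ℓ v Δ k {w}ᶜ (Sum.elim H Y)) :
    (GSampler.run ℓ v Δ H Y k).1 = some w := by
  have hsnd : (GSampler.run ℓ v Δ H Y k).2 = minLevel ℓ v Δ k {w} (Sum.elim H Y) := by
    rw [run_snd_eq_minLevel, ← Finset.union_compl {w}, minLevel_union, inf_eq_left.2 h.le]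
  cases hfst : (GSampler.run ℓ v Δ H Y k).1 with
  | none =>
    rw [run_snd_eq_top_of_fst_eq_none ℓ v Δ H Y k hfst] at hsnd
    exact absurd h (by rw [← hsnd]; exact not_top_lt)
  | some w' =>
    by_contra hne
    have hne' : w' ≠ w := fun h' => hne (by rw [h'])
    obtain ⟨i, hi, hv, hh⟩ := exists_of_run_fst_eq_some ℓ v Δ H Y k hfst
    refine absurd h (not_lt.2 ?_)
    rw [← hsnd, ← hh]
    exact Finset.inf_le (f := fun i => ℓ (Y i / Δ i) (H (v i))) (by simp [hi, hv, hne'])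

lemma measurableSet_run_fst_eq {Ω : Type*} [MeasurableSpace Ω]
    (hℓ : Measurable fun p : ℝ × ℝ => ℓ p.1 p.2) {H : Fin n → Ω → ℝ} {Y : ℕ → Ω → ℝ}
    (hH : ∀ w, Measurable (H w)) (hY : ∀ i, Measurable (Y i)) (k : ℕ) (o : Option (Fin n)) :
    MeasurableSet {ω | (GSampler.run ℓ v Δ (fun w => H w ω) (fun i => Y i ω) k).1 = o} := by
  -- The discrete σ-algebra makes each singleton event measurable.
  let _ : MeasurableSpace (Option (Fin n)) := ⊤
  have hrun : Measurable fun ω => GSampler.run ℓ v Δ (fun w => H w ω) (fun i => Y i ω) k := by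
    induction k with
    | zero => exact measurable_const
    | succ k ih =>
      have hlev : Measurable fun ω => ℓ (Y k ω / Δ k) (H (v k) ω) :=
        hℓ.comp (((hY k).div_const _).prodMk (hH _))
      exact Measurable.ite (measurableSet_lt hlev ih.snd) (measurable_const.prodMk hlev) ih
  exact hrun.fst (MeasurableSpace.measurableSet_top (s := {o}))

end Run

/-! ### Independence and the law of the least levels. -/

/-- Each function factors through the restriction to its finite set of coordinates, with the other
coordinates filled by 0. -/
lemma indepFun_of_dependsOn {ι Ω β γ : Type*} [MeasurableSpace Ω] [MeasurableSpace β]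
    [MeasurableSpace γ] {P : Measure Ω} {f : ι → Ω → ℝ}
    (hind : iIndepFun f P) (hf : ∀ i, Measurable (f i)) {S T : Finset ι} (hST : Disjoint S T)
    {φ : (ι → ℝ) → β} {ψ : (ι → ℝ) → γ} (hφ : Measurable φ) (hψ : Measurable ψ)
    (hφS : DependsOn φ (S : Set ι)) (hψT : DependsOn ψ (T : Set ι)) :
    IndepFun (fun ω => φ fun i => f i ω) (fun ω => ψ fun i => f i ω) P := by
  classical
  let extend (S : Finset ι) (x : S → ℝ) (i : ι) : ℝ := if hi : i ∈ S then x ⟨i, hi⟩ else 0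
  have hext : ∀ S, Measurable (extend S) := fun S => measurable_pi_lambda _ fun i => by
    by_cases hi : i ∈ S
    · simpa [extend, hi] using measurable_pi_apply _
    · simp [extend, hi]
  have h := (hind.indepFun_finset S T hST hf).comp (hφ.comp (hext S)) (hψ.comp (hext T))
  have h1 : (fun ω => φ fun i => f i ω) = (φ ∘ extend S) ∘ fun ω (i : S) => f i ω := by
    funext ω
    exact hφS fun i hi => by simp [extend, Finset.mem_coe.1 hi]
  have h2 : (fun ω => ψ fun i => f i ω) = (ψ ∘ extend T) ∘ fun ω (i : T) => f i ω := by
    funext ω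
    exact hψT fun i hi => by simp [extend, Finset.mem_coe.1 hi]
  rwa [h1, h2]

section Law

variable {S : Type*} [MeasurableSpace S] {Q : Measure S} {X : ℝ≥0 → S → ℝ≥0∞} {G : ℝ≥0 → ℝ}
  {Ω : Type*} [MeasurableSpace Ω] {P : Measure Ω} [IsProbabilityMeasure P]
  {n : ℕ} {H : Fin n → Ω → ℝ} {Y : ℕ → Ω → ℝ}

lemma map_prodMk_hash_eq_prod (hH : ∀ w, Measurable (H w)) (hY : ∀ i, Measurable (Y i))
    (hHlaw : ∀ w, P.map (H w) = volume.restrict (Set.Icc (0 : ℝ) 1))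
    (hYlaw : ∀ i, P.map (Y i) = expMeasure 1) (hind : iIndepFun (Sum.elim H Y) P)
    (w : Fin n) (s : Finset ℕ) :
    P.map (fun ω => (H w ω, fun i : s => Y i ω)) =
      (volume.restrict (Set.Icc (0 : ℝ) 1)).prod (Measure.pi fun _ : s => expMeasure 1) := by
  have hf : ∀ i, Measurable (Sum.elim H Y i) := Sum.rec hH hY
  have hpair : IndepFun (H w) (fun ω (i : s) => Y i ω) P := by
    refine indepFun_of_dependsOn (S := {Sum.inl w}) (T := s.map Function.Embedding.inr)
      (φ := fun z => z (.inl w)) (ψ := fun z (i : s) => z (.inr i)) hind hf ?_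
      (measurable_pi_apply _) (measurable_pi_lambda _ fun i => measurable_pi_apply _) ?_ ?_
    · simp
    · exact fun x y hxy => hxy _ (by simp)
    · exact fun x y hxy => funext fun i => hxy _ (by simp)
  have hYind : iIndepFun (fun (i : s) ω => Y i ω) P :=
    hind.precomp (g := fun i : s => Sum.inr (i : ℕ))
      (Sum.inr_injective.comp Subtype.val_injective)
  have hYm : Measurable fun ω (i : s) => Y i ω := measurable_pi_lambda _ fun i => hY i
  have hYpi : P.map (fun ω (i : s) => Y i ω) = Measure.pi fun i : s => P.map (Y i) :=
    hYind.map_fun_eq_pi_map fun i => (hY i).aemeasurable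
  rw [(indepFun_iff_map_prod_eq_prod_map_map (hH w).aemeasurable hYm.aemeasurable).1 hpair, hHlaw,
    hYpi]
  simp only [hYlaw]

lemma streamVector_eq_sum_filter (v : ℕ → Fin n) (Δ : ℕ → ℝ≥0) (k : ℕ) (w : Fin n) :
    GSampler.streamVector v Δ k w = ∑ i ∈ Finset.range k with v i ∈ ({w} : Finset (Fin n)), Δ i := by
  simp [GSampler.streamVector, Finset.sum_filter]

lemma measure_lt_minLevel_singleton (hX : GSampler.IsLevyProcessOf Q X G)
    (hH : ∀ w, Measurable (H w)) (hY : ∀ i, Measurable (Y i))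
    (hHlaw : ∀ w, P.map (H w) = volume.restrict (Set.Icc (0 : ℝ) 1))
    (hYlaw : ∀ i, P.map (Y i) = expMeasure 1) (hind : iIndepFun (Sum.elim H Y) P)
    (v : ℕ → Fin n) {Δ : ℕ → ℝ≥0} (hΔ : ∀ i, 0 < Δ i) (k : ℕ) (w : Fin n) (t : ℝ≥0) :
    P {ω | (t : ℝ≥0∞) <
      minLevel (GSampler.levelFunction Q X) v Δ k {w} fun i => Sum.elim H Y i ω} =
      ENNReal.ofReal (Real.exp (-(t * G (GSampler.streamVector v Δ k w)))) := by
  set g := G (GSampler.streamVector v Δ k w) with hg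
  set s := {i ∈ Finset.range k | v i ∈ ({w} : Finset (Fin n))} with hs
  set Z := fun ω => minLevel (GSampler.levelFunction Q X) v Δ k {w} fun i => Sum.elim H Y i ω
    with hZ
  -- Finiteness of `c` is needed when no update touches `w`, since the empty infimum is ∞.
  have hZlt : ∀ ω (c : ℝ≥0∞), c < ∞ → (c < Z ω ↔
      ∀ i ∈ s, c < GSampler.levelFunction Q X (Y i ω / Δ i) (H w ω)) := by
    intro ω c hc
    simp only [hZ, minLevel]
    rw [Finset.lt_inf_iff hc]
    refine forall₂_congr fun i hi => ?_
    have : v i = w := by simpa using (Finset.mem_filter.1 hi).2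
    simp [this]
  let B : ℝ≥0 → Set Ω := fun r => {ω | ∀ i : s,
    Q {σ | ENNReal.ofReal (Y i ω / Δ i) ≤ X r σ} < ENNReal.ofReal (H w ω)}
  have hB : ∀ r, P (B r) = ENNReal.ofReal (Real.exp (-(r * g))) := by
    intro r
    have hsum : ∑ i : s, Δ i = GSampler.streamVector v Δ k w := by
      rw [streamVector_eq_sum_filter, ← hs, Finset.sum_coe_sort s Δ]
    have key := prod_uniform_expMeasure_forall_lt hX (fun i : s => hΔ i) r
    rw [← map_prodMk_hash_eq_prod hH hY hHlaw hYlaw hind w s, Measure.map_apply, hsum] at key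
    · exact key
    · exact (hH w).prodMk (measurable_pi_lambda _ fun i => hY i)
    · rw [Set.ofPred_forall]
      refine MeasurableSet.iInter fun i => measurableSet_lt ?_
        (ENNReal.measurable_ofReal.comp measurable_fst)
      exact (measurable_measure_ofReal_le (Q := Q) (X := X) r).comp
        (((measurable_pi_apply i).comp measurable_snd).div_const _)
  -- The event {t < Z} lies in `B t` and contains `B r` for every r > t. Continuity of e^{-rg} in r
  -- closes the gap.
  apply le_antisymm
  · rw [← hB]
    refine measure_mono fun ω hω i => ?_
    by_contra hle
    exact absurd (levelFunction_le (not_lt.1 hle))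
      (not_le.2 ((hZlt ω t ENNReal.coe_lt_top).1 hω i i.2))
  · have hc : Continuous fun r : ℝ≥0 => ENNReal.ofReal (Real.exp (-(r * g))) :=
      ENNReal.continuous_ofReal.comp (by fun_prop)
    refine le_of_tendsto ((hc.tendsto t).mono_left nhdsWithin_le_nhds : Tendsto _ (𝓝[>] t) _) ?_
    refine eventually_nhdsWithin_of_forall fun r hr => ?_
    rw [← hB]
    refine measure_mono fun ω hω => (hZlt ω t ENNReal.coe_lt_top).2 fun i hi => ?_
    by_contra hle
    have hlt : GSampler.levelFunction Q X (Y i ω / Δ i) (H w ω) < r :=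
      (not_lt.1 hle).trans_lt (ENNReal.coe_lt_coe.2 hr)
    exact absurd (le_measure_of_levelFunction_lt hX.isNonnegLevyProcess hlt)
      (not_le.2 (hω ⟨i, hi⟩))

/-- Different coordinates read disjoint sets of hash values and clocks, so their tails multiply and
the rates add. -/
lemma measure_lt_minLevel (hX : GSampler.IsLevyProcessOf Q X G)
    (hH : ∀ w, Measurable (H w)) (hY : ∀ i, Measurable (Y i))
    (hHlaw : ∀ w, P.map (H w) = volume.restrict (Set.Icc (0 : ℝ) 1))
    (hYlaw : ∀ i, P.map (Y i) = expMeasure 1) (hind : iIndepFun (Sum.elim H Y) P)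
    (v : ℕ → Fin n) {Δ : ℕ → ℝ≥0} (hΔ : ∀ i, 0 < Δ i) (k : ℕ) (W : Finset (Fin n)) (t : ℝ≥0) :
    P {ω | (t : ℝ≥0∞) < minLevel (GSampler.levelFunction Q X) v Δ k W fun i => Sum.elim H Y i ω} =
      ENNReal.ofReal (Real.exp (-(t * ∑ w ∈ W, G (GSampler.streamVector v Δ k w)))) := by
  have hℓ := measurable_levelFunction hX.isNonnegLevyProcess
  induction W using Finset.induction_on with
  | empty => simp [minLevel]
  | insert w W hw ih =>
    have hpair := indepFun_of_dependsOn hind (Sum.rec hH hY)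
      (disjoint_levelSupport v k (Finset.disjoint_singleton_left.2 hw))
      (measurable_minLevel v Δ hℓ k {w}) (measurable_minLevel v Δ hℓ k W)
      (dependsOn_minLevel _ v Δ k {w}) (dependsOn_minLevel _ v Δ k W)
    have := hpair.measure_inter_preimage_eq_mul (Set.Ioi (t : ℝ≥0∞)) (Set.Ioi (t : ℝ≥0∞))
      measurableSet_Ioi measurableSet_Ioi
    rw [Finset.sum_insert hw, mul_add, neg_add, Real.exp_add,
      ENNReal.ofReal_mul (Real.exp_nonneg _), ← ih,
      ← measure_lt_minLevel_singleton hX hH hY hHlaw hYlaw hind v hΔ k w t]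
    refine Eq.trans (congrArg P ?_) this
    ext ω
    rw [Set.mem_ofPred_eq, Finset.insert_eq, minLevel_union, lt_inf_iff]
    rfl

end Law

/-! ### The main theorem. -/

theorem mainTheorem1 (G : ℝ≥0 → ℝ) (hG : G ∈ GSampler.ClassG) :
    -- a corresponding Lévy process exists
    (∃ (S : Type) (_ : MeasurableSpace S) (Q : Measure S) (X : ℝ≥0 → S → ℝ≥0∞),
      GSampler.IsLevyProcessOf Q X G) ∧
    -- and the sampler run with its level function is correct
    ∀ {S : Type*} [MeasurableSpace S] (Q : Measure S) (X : ℝ≥0 → S → ℝ≥0∞),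
      GSampler.IsLevyProcessOf Q X G →
    ∀ {Ω : Type*} [MeasurableSpace Ω] (P : Measure Ω) [IsProbabilityMeasure P]
      (n : ℕ) (H : Fin n → Ω → ℝ) (Y : ℕ → Ω → ℝ),
      (∀ w, Measurable (H w)) → (∀ i, Measurable (Y i)) →
      (∀ w, P.map (H w) = volume.restrict (Set.Icc (0 : ℝ) 1)) →
      (∀ i, P.map (Y i) = expMeasure 1) →
      iIndepFun (Sum.elim H Y) P →
    ∀ (v : ℕ → Fin n) (Δ : ℕ → ℝ≥0), (∀ i, 0 < Δ i) →
    ∀ k : ℕ,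
      let ℓ : ℝ → ℝ → ℝ≥0∞ := GSampler.levelFunction Q X
      let h : ℕ → Ω → ℝ≥0∞ := fun i ω => ℓ (Y i ω / Δ i) (H (v i) ω)
      let state : Ω → GSampler.Memory n :=
        fun ω => GSampler.run ℓ v Δ (fun w => H w ω) (fun i => Y i ω) k
      let x : Fin n → ℝ≥0 := GSampler.streamVector v Δ k
      -- the stored pair is a minimum over all updates so far
      (∀ ω, (state ω).2 = ⨅ i ∈ Finset.range k, h i ω) ∧
      (∀ ω w, (state ω).1 = some w → ∃ i < k, v i = w ∧ h i ω = (state ω).2) ∧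
      (0 < GSampler.moment G x →
        -- zero probability of failure
        (∀ᵐ ω ∂P, (state ω).1 ≠ none ∧ (state ω).2 ≠ ∞) ∧
        (∀ w, P {ω | (state ω).1 = some w} =
          ENNReal.ofReal (G (x w) / GSampler.moment G x)) ∧
        P.map (fun ω => (state ω).2) =
          (expMeasure (GSampler.moment G x)).map ENNReal.ofReal) := by

  refine ⟨exists_isLevyProcessOf hG, ?_⟩
  intro S _ Q X hX Ω _ P _ n H Y hH hY hHlaw hYlaw hind v Δ hΔ k ℓ h state x
  have hℓ : Measurable fun p : ℝ × ℝ => ℓ p.1 p.2 :=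
    measurable_levelFunction hX.isNonnegLevyProcess
  have hf : ∀ i, Measurable (Sum.elim H Y i) := Sum.rec hH hY
  have helim : ∀ ω, (Sum.elim (fun w => H w ω) fun i => Y i ω) = fun i => Sum.elim H Y i ω :=
    fun ω => funext fun i => by cases i <;> rfl
  let M : Finset (Fin n) → Ω → ℝ≥0∞ := fun W ω => minLevel ℓ v Δ k W fun i => Sum.elim H Y i ω
  have hM : ∀ W, Measurable (M W) := fun W =>
    (measurable_minLevel v Δ hℓ k W).comp (measurable_pi_lambda _ hf)
  have hMt : ∀ W (t : ℝ≥0), P {ω | (t : ℝ≥0∞) < M W ω} =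
      ENNReal.ofReal (Real.exp (-(t * ∑ w ∈ W, G (x w)))) :=
    measure_lt_minLevel hX hH hY hHlaw hYlaw hind v hΔ k
  have hG0 : ∀ z, 0 ≤ G z := by
    obtain ⟨d, μ, -, hμ⟩ := exists_bernsteinExponent_eq hG
    exact fun z => (hμ z).1
  have hsnd : ∀ ω, (state ω).2 = M Finset.univ ω := fun ω => by
    simp only [M, ← helim]
    exact run_snd_eq_minLevel ℓ v Δ _ _ k
  refine ⟨fun ω => ?_, fun ω w hw => ?_, fun hpos => ?_⟩
  · rw [← Finset.inf_eq_iInf]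
    exact run_snd ℓ v Δ _ _ k
  · obtain ⟨i, hi, hv, hh⟩ := exists_of_run_fst_eq_some ℓ v Δ _ _ k hw
    exact ⟨i, hi, hv, hh⟩
  have hlaw : P.map (fun ω => (state ω).2) =
      (expMeasure (GSampler.moment G x)).map ENNReal.ofReal := by
    simp only [hsnd]
    exact map_eq_map_expMeasure (hM _) hpos (hMt Finset.univ)
  have hfin : ∀ᵐ ω ∂P, (state ω).2 ≠ ∞ := by
    have hset : MeasurableSet {y : ℝ≥0∞ | y ≠ ∞} := (measurableSet_singleton _).compl
    have h1 : ∀ᵐ y ∂(P.map fun ω => (state ω).2), y ≠ ∞ := by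
      rw [hlaw, ae_map_iff ENNReal.measurable_ofReal.aemeasurable hset]
      exact .of_forall fun y => ENNReal.ofReal_ne_top
    simp only [hsnd] at h1 ⊢
    exact ae_of_ae_map (hM _).aemeasurable h1
  have hmeas : ∀ w, MeasurableSet {ω | (state ω).1 = some w} := fun w =>
    measurableSet_run_fst_eq ℓ v Δ hℓ hH hY k (some w)
  have hge : ∀ w, ENNReal.ofReal (G (x w) / GSampler.moment G x) ≤
      P {ω | (state ω).1 = some w} := by
    intro w
    -- The race needs a positive rate for `w`; at rate 0 the lower bound is trivial.
    rcases (hG0 (x w)).eq_or_lt with h0 | h0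
    · simp [← h0]
    have hpair : IndepFun (M {w}) (M {w}ᶜ) P :=
      indepFun_of_dependsOn hind hf (disjoint_levelSupport v k disjoint_compl_right)
        (measurable_minLevel v Δ hℓ k {w}) (measurable_minLevel v Δ hℓ k {w}ᶜ)
        (dependsOn_minLevel _ v Δ k {w}) (dependsOn_minLevel _ v Δ k {w}ᶜ)
    have hlt := measure_lt_of_indepFun_exponential (hM {w}) (hM {w}ᶜ) hpair h0
      (Finset.sum_nonneg fun w' _ => hG0 (x w')) (by simpa using hMt {w}) (hMt {w}ᶜ)
    have hsum : G (x w) + ∑ w' ∈ {w}ᶜ, G (x w') = GSampler.moment G x := by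
      rw [GSampler.moment, ← Finset.sum_add_sum_compl {w}, Finset.sum_singleton]
    rw [← hsum, ← hlt]
    refine measure_mono fun ω hω => run_fst_eq_some_of_minLevel_lt ℓ v Δ _ _ k ?_
    rw [helim]
    exact hω
  have hsum_le : ∑ w, P {ω | (state ω).1 = some w} ≤ 1 := by
    have hdisj : Set.PairwiseDisjoint ((Finset.univ : Finset (Fin n)) : Set (Fin n))
        fun w => {ω | (state ω).1 = some w} :=
      fun w _ w' _ hne => Set.disjoint_left.2 fun ω h1 h2 =>
        hne (Option.some_injective _ ((Eq.symm h1).trans h2))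
    rw [← measure_biUnion_finset hdisj fun w _ => hmeas w]
    exact prob_le_one
  have hsum_eq : ∑ w, ENNReal.ofReal (G (x w) / GSampler.moment G x) = 1 := by
    rw [← ENNReal.ofReal_sum_of_nonneg fun w _ => div_nonneg (hG0 _) hpos.le, ← Finset.sum_div]
    change ENNReal.ofReal (GSampler.moment G x / GSampler.moment G x) = 1
    rw [div_self hpos.ne', ENNReal.ofReal_one]
  refine ⟨hfin.mono fun ω hω => ⟨fun hnone => hω ?_, hω⟩, fun w => ?_, hlaw⟩
  · exact run_snd_eq_top_of_fst_eq_none ℓ v Δ _ _ k hnone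
  -- The lower bounds already sum to 1 while the probabilities sum to at most 1, so none of the
  -- bounds can be strict.
  · refine le_antisymm ?_ (hge w)
    have hne : ∑ w' ∈ {w}ᶜ, P {ω | (state ω).1 = some w'} ≠ ∞ := by simp
    refine ENNReal.le_of_add_le_add_right hne ?_
    calc P {ω | (state ω).1 = some w} + ∑ w' ∈ {w}ᶜ, P {ω | (state ω).1 = some w'}
        = ∑ w, P {ω | (state ω).1 = some w} := by
          rw [← Finset.sum_add_sum_compl {w}, Finset.sum_singleton]
      _ ≤ ∑ w, ENNReal.ofReal (G (x w) / GSampler.moment G x) := hsum_le.trans hsum_eq.ge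
      _ = ENNReal.ofReal (G (x w) / GSampler.moment G x) +
          ∑ w' ∈ {w}ᶜ, ENNReal.ofReal (G (x w') / GSampler.moment G x) := by
          rw [← Finset.sum_add_sum_compl {w}, Finset.sum_singleton]
      _ ≤ _ := by
          gcongr with w' _
          exact hge w'
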